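/- Let $G$ be an amenable, second countable, locally compact Hausdorff group with left Haar measure $\mu$, and let $\lambda_G\colon G\to\mathcal{B}(L^2(G,\mu))$, $(\lambda_G(g)f)(x)=f(g^{-1}x)$, be its left regular representation. Here $G$ is called amenable if there is a left-invariant mean on $L^\infty(G,\mu)$. Let $C^*(G)$ be the group $C^*$-algebra of $G$, that is, the completion of $L^1(G,\mu)$ with respect to the norm $\|f\|=\sup_\pi\|\pi(f)\|$, where $\pi$ runs over the strongly continuous unitary representations of $G$ and $\pi(f)=\int_G f(x)\pi(x)\,d\mu(x)$. If $\lambda_G$ is a factor representation, that is, if the von Neumann algebra $\lambda_G(G)''$ has centre $\mathbb{C}1$, then $C^*(G)$ is primitive, that is, there is a faithful irreducible $*$-representation of $C^*(G)$ on a Hilbert space. -/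

import Mathlib

open MeasureTheory
open scoped ENNReal

universe u v

noncomputable section

/-! ### Unitary representations -/

/-- A unitary representation of the topological group `G` on the complex Hilbert space `H`: a
homomorphism into the group of unitary operators of `H` (linear isometric bijections) which is
continuous for the strong operator topology. -/
structure UnitaryRep (G : Type u) [Group G] [TopologicalSpace G]
    (H : Type v) [NormedAddCommGroup H] [InnerProductSpace ℂ H] where
  /-- The underlying homomorphism into the unitary group. -/
  toHom : G →* (H ≃ₗᵢ[ℂ] H)
  /-- Strong operator continuity. -/
  continuous_orbit : ∀ v : H, Continuous fun g : G => toHom g v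

namespace UnitaryRep

variable {G : Type u} [Group G] [TopologicalSpace G]
  {H : Type v} [NormedAddCommGroup H] [InnerProductSpace ℂ H]

/-- The unitary operator `π g` as an element of the algebra `B(H)` of bounded operators. -/
def op (π : UnitaryRep G H) (g : G) : H →L[ℂ] H :=
  (π.toHom g).toContinuousLinearEquiv.toContinuousLinearMap

@[simp]
theorem op_apply (π : UnitaryRep G H) (g : G) (v : H) : π.op g v = π.toHom g v := rfl

end UnitaryRep

/-! ### The left regular representation -/

section Regular

variable {G : Type u} [Group G] [TopologicalSpace G] [IsTopologicalGroup G]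
  [LocallyCompactSpace G] [T2Space G] [SecondCountableTopology G]
  [MeasurableSpace G] [BorelSpace G] (μ : Measure G) [μ.IsHaarMeasure]

/-- The left translation `(L_g f)(x) = f (g⁻¹ x)` as a linear isometry of `L²(G, μ)`. -/
def leftTranslate (g : G) : Lp ℂ 2 μ →ₗᵢ[ℂ] Lp ℂ 2 μ :=
  Lp.compMeasurePreservingₗᵢ ℂ (fun x => g⁻¹ * x) (measurePreserving_mul_left μ g⁻¹)

theorem leftTranslate_apply_eq (g : G) (f : Lp ℂ 2 μ) :
    leftTranslate μ g f = (DomMulAct.mk g⁻¹) • f := rfl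

theorem leftTranslate_coeFn (g : G) (f : Lp ℂ 2 μ) :
    leftTranslate μ g f =ᵐ[μ] fun x => f (g⁻¹ * x) :=
  Lp.coeFn_compMeasurePreserving f (measurePreserving_mul_left μ g⁻¹)

theorem leftTranslate_one (f : Lp ℂ 2 μ) : leftTranslate μ 1 f = f := by
  rw [leftTranslate_apply_eq, inv_one, DomMulAct.mk_one, one_smul]

theorem leftTranslate_mul (g h : G) (f : Lp ℂ 2 μ) :
    leftTranslate μ (g * h) f = leftTranslate μ g (leftTranslate μ h f) := by
  rw [leftTranslate_apply_eq, leftTranslate_apply_eq, leftTranslate_apply_eq, smul_smul,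
    ← DomMulAct.mk_mul, mul_inv_rev]

/-- The left regular representation `λ_G` of `G` on `L²(G, μ)`, for a left Haar measure `μ`:
`(λ_G(g) f)(x) = f (g⁻¹ x)`. -/
def regularRep : UnitaryRep G (Lp ℂ 2 μ) where
  toHom :=
    { toFun := fun g =>
        { (leftTranslate μ g).toLinearMap with
          invFun := leftTranslate μ g⁻¹
          left_inv := fun f => by
            change leftTranslate μ g⁻¹ (leftTranslate μ g f) = f
            rw [← leftTranslate_mul, inv_mul_cancel, leftTranslate_one]
          right_inv := fun f => by
            change leftTranslate μ g (leftTranslate μ g⁻¹ f) = f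
            rw [← leftTranslate_mul, mul_inv_cancel, leftTranslate_one]
          norm_map' := fun f => (leftTranslate μ g).norm_map f }
      map_one' := by
        ext1 f
        exact leftTranslate_one μ f
      map_mul' := fun g h => by
        ext1 f
        exact leftTranslate_mul μ g h f }
  continuous_orbit := fun f => by
    let _ : PseudoMetricSpace G := TopologicalSpace.pseudoMetrizableSpacePseudoMetric G
    have : Fact ((2 : ℝ≥0∞) ≠ ∞) := ⟨ENNReal.ofNat_ne_top⟩
    have : μ.InnerRegularCompactLTTop := inferInstance
    change Continuous fun g : G => (DomMulAct.mk g⁻¹) • f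
    exact (DomMulAct.continuous_mk.comp continuous_inv).smul continuous_const

end Regular

/-! ### Von Neumann algebras and factors -/

section VN

variable {H : Type v} [NormedAddCommGroup H] [InnerProductSpace ℂ H] [CompleteSpace H]

/-- The von Neumann algebra generated by a set `S` of bounded operators: the double commutant
of `S ∪ S*`. -/
def VonNeumannAlgebra.generated (S : Set (H →L[ℂ] H)) : VonNeumannAlgebra H where
  toStarSubalgebra := StarSubalgebra.centralizer ℂ (StarSubalgebra.centralizer ℂ S : Set (H →L[ℂ] H))
  centralizer_centralizer' := by
    change Set.centralizer (Set.centralizer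
      ((StarSubalgebra.centralizer ℂ (StarSubalgebra.centralizer ℂ S : Set (H →L[ℂ] H)) :
        StarSubalgebra ℂ (H →L[ℂ] H)) : Set (H →L[ℂ] H))) =
      ((StarSubalgebra.centralizer ℂ (StarSubalgebra.centralizer ℂ S : Set (H →L[ℂ] H)) :
        StarSubalgebra ℂ (H →L[ℂ] H)) : Set (H →L[ℂ] H))
    rw [StarSubalgebra.coe_centralizer_centralizer, Set.centralizer_centralizer_centralizer]

theorem VonNeumannAlgebra.subset_generated (S : Set (H →L[ℂ] H)) :
    S ⊆ (VonNeumannAlgebra.generated S : Set (H →L[ℂ] H)) := by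
  change S ⊆ ((StarSubalgebra.centralizer ℂ (StarSubalgebra.centralizer ℂ S : Set (H →L[ℂ] H)) :
    StarSubalgebra ℂ (H →L[ℂ] H)) : Set (H →L[ℂ] H))
  rw [StarSubalgebra.coe_centralizer_centralizer]
  exact Set.subset_union_left.trans Set.subset_centralizer_centralizer

/-- A von Neumann algebra `M` on a nonzero Hilbert space is a factor if its centre `M ∩ M'`
consists of the scalar multiples of the identity. -/
def VonNeumannAlgebra.IsFactor (M : VonNeumannAlgebra H) : Prop :=
  Nontrivial H ∧ ∀ z : H →L[ℂ] H, z ∈ M → z ∈ M.commutant → ∃ c : ℂ, z = c • (1 : H →L[ℂ] H)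

/-- A factor representation: a unitary representation which generates a factor. -/
def UnitaryRep.IsFactorRep {G : Type u} [Group G] [TopologicalSpace G]
    (π : UnitaryRep G H) : Prop :=
  (VonNeumannAlgebra.generated (Set.range π.op)).IsFactor

end VN

/-! ### Amenability -/

section Amenable

variable {G : Type u} [Group G] [TopologicalSpace G] [IsTopologicalGroup G]
  [MeasurableSpace G] [BorelSpace G]

/-- Amenability of a locally compact group `G` with left Haar measure `μ`: there is a
left-invariant mean on the real `L^∞(G, μ)`, that is, a linear functional which is positive,
takes the value `1` on the constant function `1`, and is invariant under the left translations
`f ↦ f (g · )`. -/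
def IsAmenableGroup (μ : Measure G) [μ.IsHaarMeasure] : Prop :=
  ∃ m : Lp ℝ ∞ μ →ₗ[ℝ] ℝ,
    (∀ f : Lp ℝ ∞ μ, 0 ≤ f → 0 ≤ m f) ∧
    m ((memLp_top_const (1 : ℝ)).toLp (fun _ : G => (1 : ℝ))) = 1 ∧
    ∀ (g : G) (f : Lp ℝ ∞ μ),
      m (Lp.compMeasurePreserving (fun x => g * x) (measurePreserving_mul_left μ g) f) = m f

end Amenable

/-! ### The group C*-algebra -/

/-- A norm closed *-subalgebra of a C*-algebra is a C*-algebra. -/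
abbrev NonUnitalStarSubalgebra.cstarAlgebraOfIsClosed {A : Type v} [NonUnitalCStarAlgebra A]
    (S : NonUnitalStarSubalgebra ℂ A) (hS : IsClosed (S : Set A)) : NonUnitalCStarAlgebra S where
  toCompleteSpace := hS.completeSpace_coe
  norm_mul_self_le x := CStarRing.norm_star_mul_self (x := (x : A)) |>.symm.le
  norm_smul_le c x := norm_smul_le c (x : A)

section GroupCStar

variable {G : Type u} [Group G] [TopologicalSpace G]
  [SecondCountableTopology G] [MeasurableSpace G] [BorelSpace G]

namespace UnitaryRep

variable {H : Type v} [NormedAddCommGroup H] [InnerProductSpace ℂ H]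
  (π : UnitaryRep G H) (μ : Measure G)

theorem integrable_smul_orbit (f : Lp ℂ 1 μ) (v : H) :
    Integrable (fun x => f x • π.toHom x v) μ := by
  have hf : Integrable f μ := L1.integrable_coeFn f
  refine (hf.norm.mul_const ‖v‖).mono'
    (hf.aestronglyMeasurable.smul (π.continuous_orbit v).aestronglyMeasurable) ?_
  exact Filter.Eventually.of_forall fun x => by
    rw [norm_smul, LinearIsometryEquiv.norm_map]

theorem norm_integral_smul_orbit_le (f : Lp ℂ 1 μ) (v : H) :
    ‖∫ x, f x • π.toHom x v ∂μ‖ ≤ ‖f‖ * ‖v‖ := by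
  refine (norm_integral_le_integral_norm _).trans (le_of_eq ?_)
  rw [L1.norm_eq_integral_norm, ← integral_mul_const]
  exact integral_congr_ae (Filter.Eventually.of_forall fun x => by
    simp only [norm_smul, LinearIsometryEquiv.norm_map])

/-- The integrated form `π(f) v = ∫ f(x) π(x) v dμ(x)` of a unitary representation,
as a bounded linear map `f ↦ π(f)` from `L¹(G, μ)` to `B(H)`. -/
def integrated : Lp ℂ 1 μ →L[ℂ] (H →L[ℂ] H) :=
  LinearMap.mkContinuous₂
    (LinearMap.mk₂ ℂ (fun (f : Lp ℂ 1 μ) (v : H) => ∫ x, f x • π.toHom x v ∂μ)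
      (fun f₁ f₂ v => by
        rw [← integral_add (π.integrable_smul_orbit μ f₁ v) (π.integrable_smul_orbit μ f₂ v)]
        refine integral_congr_ae ?_
        filter_upwards [Lp.coeFn_add f₁ f₂] with x hx
        rw [hx, Pi.add_apply, add_smul])
      (fun c f v => by
        rw [← integral_smul]
        refine integral_congr_ae ?_
        filter_upwards [Lp.coeFn_smul c f] with x hx
        rw [hx, Pi.smul_apply, smul_assoc])
      (fun f v₁ v₂ => by
        rw [← integral_add (π.integrable_smul_orbit μ f v₁) (π.integrable_smul_orbit μ f v₂)]
        simp only [map_add, smul_add])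
      (fun c f v => by
        rw [← integral_smul]
        simp only [map_smul, smul_comm c]))
    1 (fun f v => by
      rw [one_mul]
      exact π.norm_integral_smul_orbit_le μ f v)

theorem integrated_apply (f : Lp ℂ 1 μ) (v : H) :
    π.integrated μ f v = ∫ x, f x • π.toHom x v ∂μ := rfl

theorem norm_integrated_le (f : Lp ℂ 1 μ) : ‖π.integrated μ f‖ ≤ ‖f‖ :=
  ContinuousLinearMap.opNorm_le_bound _ (norm_nonneg f) fun v =>
    π.norm_integral_smul_orbit_le μ f v

end UnitaryRep

variable (G) in
/-- The index set of the universal representation: all unitary representations of `G` on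
Hilbert spaces (in the universe of `G`, which contains, up to unitary equivalence, all cyclic
representations of `G`). -/
structure RepIndex : Type (u + 1) where
  /-- The Hilbert space. -/
  H : Type u
  /-- It is a normed group, -/
  [normed : NormedAddCommGroup H]
  /-- whose norm comes from an inner product, -/
  [inner : InnerProductSpace ℂ H]
  /-- and it is complete. -/
  [complete : CompleteSpace H]
  /-- The unitary representation. -/
  rep : UnitaryRep G H

attribute [instance] RepIndex.normed RepIndex.inner RepIndex.complete

variable (G) in
/-- The C*-algebra of all bounded families `(T_π)` with `T_π ∈ B(H_π)`, where `π` runs over all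
unitary representations of `G`, with the norm `sup_π ‖T_π‖` and pointwise operations. These are
the block-diagonal operators on the space of the universal representation. -/
def UniversalBlocks : Type (u + 1) := lp (fun i : RepIndex G => i.H →L[ℂ] i.H) ∞

instance UniversalBlocks.instNonUnitalCStarAlgebra : NonUnitalCStarAlgebra (UniversalBlocks G) :=
  inferInstanceAs (NonUnitalCStarAlgebra (lp (fun i : RepIndex G => i.H →L[ℂ] i.H) ∞))

/-- The block `T_π` of a family `(T_π)_π`. -/
def UniversalBlocks.block (i : RepIndex G) : UniversalBlocks G →⋆ₙₐ[ℂ] (i.H →L[ℂ] i.H) where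
  toFun T := T.1 i
  map_smul' _ _ := rfl
  map_zero' := rfl
  map_add' _ _ := rfl
  map_mul' _ _ := rfl
  map_star' _ := rfl

/-- The universal representation `f ↦ (π(f))_π` of `L¹(G, μ)`. The norm of the image of `f` is the
maximal C*-norm `sup_π ‖π(f)‖`. -/
def universalRep (μ : Measure G) (f : Lp ℂ 1 μ) : UniversalBlocks G :=
  ⟨fun i => i.rep.integrated μ f, memℓp_infty ⟨‖f‖, by
    rintro _ ⟨i, rfl⟩
    exact i.rep.norm_integrated_le μ f⟩⟩

@[simp]
theorem block_universalRep (μ : Measure G) (f : Lp ℂ 1 μ) (i : RepIndex G) :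
    UniversalBlocks.block i (universalRep μ f) = i.rep.integrated μ f := rfl

theorem norm_universalRep (μ : Measure G) (f : Lp ℂ 1 μ) :
    ‖universalRep μ f‖ = ⨆ i : RepIndex G, ‖i.rep.integrated μ f‖ := rfl

/-- The (full) group C*-algebra `C*(G)`, that is, the completion of `L¹(G, μ)` in the maximal
C*-norm `‖f‖_max = sup_π ‖π(f)‖` (`π` running over the unitary representations of `G`),
realized as the C*-algebra generated by the image of `L¹(G, μ)` in the universal representation.
(As `π(f) π(h) = π(f * h)` and `π(f)* = π(f*)` for the convolution and involution of `L¹(G, μ)`,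
the image of `L¹(G, μ)` is already a *-algebra, and `C*(G)` is its norm closure.) -/
def GroupCStarAlgebra (μ : Measure G) : NonUnitalStarSubalgebra ℂ (UniversalBlocks G) :=
  (NonUnitalStarAlgebra.adjoin ℂ (Set.range (universalRep μ))).topologicalClosure

instance GroupCStarAlgebra.instNonUnitalCStarAlgebra (μ : Measure G) :
    NonUnitalCStarAlgebra (GroupCStarAlgebra μ) :=
  (GroupCStarAlgebra μ).cstarAlgebraOfIsClosed
    (NonUnitalStarSubalgebra.isClosed_topologicalClosure _)

end GroupCStar

/-! ### Irreducible representations and primitivity of C*-algebras -/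

section Primitive

variable {A : Type u} [NonUnitalCStarAlgebra A]
  {H : Type v} [NormedAddCommGroup H] [InnerProductSpace ℂ H] [CompleteSpace H]

/-- A *-representation `π` of a C*-algebra on `H` is (topologically) irreducible if it is nonzero
and the only closed subspaces of `H` invariant under all `π(a)` are `0` and `H`. -/
def IsIrreducibleRep (π : A →⋆ₙₐ[ℂ] (H →L[ℂ] H)) : Prop :=
  (∃ a : A, π a ≠ 0) ∧
  ∀ K : Submodule ℂ H, IsClosed (K : Set H) → (∀ a : A, ∀ v ∈ K, π a v ∈ K) → K = ⊥ ∨ K = ⊤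

/-- A C*-algebra is primitive if it has a faithful irreducible *-representation on a
Hilbert space. -/
def IsPrimitiveCStarAlgebra (A : Type u) [NonUnitalCStarAlgebra A] : Prop :=
  ∃ (H : Type v) (_ : NormedAddCommGroup H) (_ : InnerProductSpace ℂ H) (_ : CompleteSpace H)
    (π : A →⋆ₙₐ[ℂ] (H →L[ℂ] H)), IsIrreducibleRep π ∧ Function.Injective π

end Primitive

end

/-!
An amenable group has a faithful regular representation on its full group C*-algebra, so that
`C*(G)` is, up to a unit, the C*-algebra generated by the operators `λ(f)`, `f ∈ L¹(G)`. If `λ`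
generates a factor, this C*-algebra is prime, and a separable prime C*-algebra is primitive.

*Amenability.* A left-invariant mean is a functional on `L^∞ = (L¹)*`. It vanishes on the
functionals `k ↦ Φ(b * k)` with `∫ b = 0`, so by Hahn-Banach separation `b * k` can be made small in
norm by a probability density `k`, for finitely many such `b` at a time
(`IsAmenableGroup.exists_density_norm_convL1_lt`). Square roots of densities obtained in this way
are unit vectors of `L²` that are asymptotically invariant under translation by every group element
(`IsAmenableGroup.exists_almost_invariant`). For a unitary representation `π` on `H` and a vector
`ξ` of `L²(G)`, the operator `v ↦ (x ↦ ξ(x) π(x)⁻¹ v)` from `H` to `L²(G; H)` turns `π` into left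
translation up to a translation of `ξ` (Fell's absorption principle). Applied to asymptotically
invariant unit vectors, it shows that an element of `C*(G)` that is killed by `λ` is killed by
every `π` (`IsAmenableGroup.eq_zero_of_block_regular_eq_zero`).

*Primeness.* If `a B b = 0` for the unital C*-algebra `B` generated by the `λ(f)`, then `a` vanishes
on the closed subspace spanned by all `λ(g) b h`. The projection onto that subspace commutes with
`λ(G)` and with `λ(G)'`, so it is central in `λ(G)''`, hence `0` or `1`
(`UnitaryRep.IsFactorRep.prime`).

*Primitivity.* Separability of `B` provides countably many nonzero elements such that a
representation killing none of them is injective. Primeness gives positive contractions `c n` in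
the ideals generated by these elements, any finite number of which act as the identity on a common
nonzero element. By compactness some state takes the value `1` at all `c n`. Such states form a
closed face of the state space; an extreme point of this face is a pure state, whose GNS
representation is injective and irreducible (`exists_injective_irreducible_of_prime`).
-/

noncomputable section

section SeparablePrime

open scoped ComplexOrder InnerProductSpace

/-! ### Separable prime C*-algebras are primitive -/

section States

variable {B : Type u} [CStarAlgebra B] [PartialOrder B] [StarOrderedRing B]

variable (B) in
/-- The state space of a unital C*-algebra, with the weak-* topology. -/
def stateSpace : Set (WeakDual ℂ B) := {φ | (∀ a : B, 0 ≤ a → 0 ≤ φ a) ∧ φ 1 = 1}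

/-- A state, as a positive linear functional. -/
def positiveOfState (φ : WeakDual ℂ B) (hφ : φ ∈ stateSpace B) : B →ₚ[ℂ] ℂ :=
  { (φ : B →ₗ[ℂ] ℂ) with
    monotone' := fun a b hab => by
      have h := hφ.1 (b - a) (sub_nonneg.2 hab)
      rw [map_sub] at h
      exact sub_nonneg.1 h }

theorem positiveOfState_apply (φ : WeakDual ℂ B) (hφ : φ ∈ stateSpace B) (a : B) :
    positiveOfState φ hφ a = φ a := rfl

theorem norm_apply_le_of_mem_stateSpace {φ : WeakDual ℂ B} (hφ : φ ∈ stateSpace B) (a : B) :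
    ‖φ a‖ ≤ 4 * ‖a‖ := by
  obtain ⟨y, hy0, hyn, hy⟩ := CStarAlgebra.exists_sum_four_nonneg a
  conv_lhs => rw [hy]
  rw [map_sum]
  refine (norm_sum_le _ _).trans ?_
  calc ∑ i : Fin 4, ‖φ (Complex.I ^ (i : ℕ) • y i)‖ ≤ ∑ _i : Fin 4, ‖a‖ := by
        refine Finset.sum_le_sum fun i _ => ?_
        rw [map_smul, norm_smul, norm_pow, Complex.norm_I, one_pow, one_mul]
        have h := PositiveLinearMap.norm_apply_le_of_nonneg (positiveOfState φ hφ) (y i) (hy0 i)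
        rw [positiveOfState_apply, positiveOfState_apply, hφ.2, norm_one, one_mul] at h
        exact h.trans (hyn i)
    _ = 4 * ‖a‖ := by simp

theorem isClosed_stateSpace : IsClosed (stateSpace B) := by
  have h : stateSpace B = (⋂ a : {a : B // 0 ≤ a}, {φ : WeakDual ℂ B | 0 ≤ φ a}) ∩
      {φ : WeakDual ℂ B | φ 1 = 1} := by
    ext φ
    simp [stateSpace]
  rw [h]
  refine (isClosed_iInter fun a => ?_).inter ?_
  · exact isClosed_le continuous_const (WeakDual.eval_continuous (a : B))
  · exact isClosed_eq (WeakDual.eval_continuous (1 : B)) continuous_const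

theorem isCompact_stateSpace : IsCompact (stateSpace B) := by
  refine (WeakDual.isCompact_closedBall (0 : StrongDual ℂ B) 4).of_isClosed_subset
    isClosed_stateSpace fun φ hφ => ?_
  rw [Set.mem_preimage, mem_closedBall_zero_iff]
  exact ContinuousLinearMap.opNorm_le_bound _ (by norm_num)
    (norm_apply_le_of_mem_stateSpace hφ)

section VectorState

variable {H : Type v} [NormedAddCommGroup H] [InnerProductSpace ℂ H] [CompleteSpace H]

/-- The vector functional `a ↦ ⟨v, ρ(a) v⟩` of a representation `ρ`. -/
def vectorFunctional (ρ : B →⋆ₐ[ℂ] (H →L[ℂ] H)) (v : H) : WeakDual ℂ B :=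
  StrongDual.toWeakDual ((innerSL ℂ v) ∘L (ContinuousLinearMap.apply ℂ H v) ∘L
    (⟨ρ.toLinearMap, map_continuous ρ⟩ : B →L[ℂ] (H →L[ℂ] H)))

theorem vectorFunctional_apply (ρ : B →⋆ₐ[ℂ] (H →L[ℂ] H)) (v : H) (a : B) :
    vectorFunctional ρ v a = ⟪v, ρ a v⟫_ℂ := rfl

theorem vectorFunctional_nonneg (ρ : B →⋆ₐ[ℂ] (H →L[ℂ] H)) (v : H) {a : B} (ha : 0 ≤ a) :
    0 ≤ vectorFunctional ρ v a := by
  obtain ⟨b, rfl⟩ := CStarAlgebra.nonneg_iff_eq_star_mul_self.1 ha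
  rw [vectorFunctional_apply, map_mul, map_star, mul_apply_eq_comp,
    ContinuousLinearMap.star_eq_adjoint, ContinuousLinearMap.adjoint_inner_right]
  rw [inner_self_eq_norm_sq_to_K, ← RCLike.ofReal_pow]
  exact RCLike.ofReal_nonneg.2 (sq_nonneg _)

theorem vectorFunctional_mem_stateSpace (ρ : B →⋆ₐ[ℂ] (H →L[ℂ] H)) {v : H} (hv : ‖v‖ = 1) :
    vectorFunctional ρ v ∈ stateSpace B := by
  refine ⟨fun a ha => vectorFunctional_nonneg ρ v ha, ?_⟩
  rw [vectorFunctional_apply, map_one, one_apply_eq_self,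
    inner_self_eq_norm_sq_to_K, hv]
  simp

end VectorState

/-- The states which vanish on a given family of positive elements. -/
def stateFace {ι : Type*} (d : ι → B) : Set (WeakDual ℂ B) :=
  {φ | φ ∈ stateSpace B ∧ ∀ n, φ (d n) = 0}

theorem isClosed_stateFace {ι : Type*} (d : ι → B) : IsClosed (stateFace d) := by
  have h : stateFace d = stateSpace B ∩ ⋂ n, {φ : WeakDual ℂ B | φ (d n) = 0} := by
    ext φ
    simp [stateFace]
  rw [h]
  exact isClosed_stateSpace.inter (isClosed_iInter fun n =>
    isClosed_eq (WeakDual.eval_continuous (d n)) continuous_const)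

theorem isCompact_stateFace {ι : Type*} (d : ι → B) : IsCompact (stateFace d) :=
  isCompact_stateSpace.of_isClosed_subset (isClosed_stateFace d) fun _ h => h.1

end States

section GNS

variable {B : Type u} [CStarAlgebra B] [PartialOrder B] [StarOrderedRing B]

/-- The canonical cyclic vector of the GNS representation. -/
def gnsVector (f : B →ₚ[ℂ] ℂ) : f.GNS := (f.toPreGNS 1 : f.PreGNS)

theorem gnsStarAlgHom_gnsVector (f : B →ₚ[ℂ] ℂ) (a : B) :
    f.gnsStarAlgHom a (gnsVector f) = (f.toPreGNS a : f.PreGNS) := by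
  change f.gnsNonUnitalStarAlgHom a (f.toPreGNS 1 : f.PreGNS) = _
  rw [PositiveLinearMap.gnsNonUnitalStarAlgHom_apply_coe]
  simp

theorem inner_gnsVector (f : B →ₚ[ℂ] ℂ) (a : B) :
    ⟪gnsVector f, f.gnsStarAlgHom a (gnsVector f)⟫_ℂ = f a := by
  rw [gnsStarAlgHom_gnsVector, gnsVector, UniformSpace.Completion.inner_coe,
    PositiveLinearMap.preGNS_inner_def]
  simp

theorem denseRange_gnsVector (f : B →ₚ[ℂ] ℂ) :
    DenseRange fun a => f.gnsStarAlgHom a (gnsVector f) := by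
  have h : (fun a => f.gnsStarAlgHom a (gnsVector f)) =
      (fun x : f.PreGNS => (x : f.GNS)) ∘ f.toPreGNS := by
    funext a
    exact gnsStarAlgHom_gnsVector f a
  rw [h]
  exact UniformSpace.Completion.denseRange_coe.comp f.toPreGNS.surjective.denseRange
    (UniformSpace.Completion.continuous_coe _)

/-- A cyclic representation is irreducible if its cyclic vector induces an extreme point of a face
of the state space. The face property is used in the form of `stateFace`: a convex decomposition
of a state vanishing on the positive elements `d n` consists of states vanishing on them. -/
theorem eq_bot_or_eq_top_of_mem_extremePoints {ι : Type*} {d : ι → B} (hd : ∀ n, 0 ≤ d n)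
    {H : Type v} [NormedAddCommGroup H] [InnerProductSpace ℂ H] [CompleteSpace H]
    (ρ : B →⋆ₐ[ℂ] (H →L[ℂ] H)) {ξ : H} (hcyc : DenseRange fun a => ρ a ξ)
    (hext : vectorFunctional ρ ξ ∈ (stateFace d).extremePoints ℝ)
    (K : Submodule ℂ H) (hK : IsClosed (K : Set H)) (hinv : ∀ a : B, ∀ v ∈ K, ρ a v ∈ K) :
    K = ⊥ ∨ K = ⊤ := by
  set φ := vectorFunctional ρ ξ with hφdef
  have hφ : ∀ a, φ a = ⟪ξ, ρ a ξ⟫_ℂ := fun a => rfl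
  have hφS : φ ∈ stateSpace B := hext.1.1
  have hφd : ∀ n, φ (d n) = 0 := hext.1.2
  have : CompleteSpace K := hK.completeSpace_coe
  have hinv' : ∀ a : B, ∀ v ∈ Kᗮ, ρ a v ∈ Kᗮ := by
    intro a v hv
    rw [Submodule.mem_orthogonal] at hv ⊢
    intro k hk
    rw [← ContinuousLinearMap.adjoint_inner_left, ← ContinuousLinearMap.star_eq_adjoint,
      ← map_star]
    exact hv _ (hinv _ k hk)
  set x := K.starProjection ξ with hx
  set y := ξ - x with hy
  have hxK : x ∈ K := K.starProjection_apply_mem ξ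
  have hyK : y ∈ Kᗮ := K.sub_starProjection_mem_orthogonal ξ
  have hsum : ξ = x + y := by rw [hy]; abel
  have hdense : ∀ (L : Submodule ℂ H), IsClosed (L : Set H) → ξ ∈ L →
      (∀ a, ∀ v ∈ L, ρ a v ∈ L) → L = ⊤ := by
    intro L hL hξL hLinv
    rw [eq_top_iff]
    intro z _
    have h1 : Set.range (fun a => ρ a ξ) ⊆ (L : Set H) := by
      rintro _ ⟨a, rfl⟩
      exact hLinv a ξ hξL
    exact closure_minimal h1 hL (hcyc z)
  by_cases hx0 : x = 0
  · left
    have h : Kᗮ = ⊤ := hdense Kᗮ K.isClosed_orthogonal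
      (by rw [hsum, hx0, zero_add]; exact hyK) hinv'
    rwa [Submodule.orthogonal_eq_top_iff] at h
  by_cases hy0 : y = 0
  · right
    exact hdense K hK (by rw [hsum, hy0, add_zero]; exact hxK) hinv
  exfalso
  -- Otherwise the decomposition of `ξ` along `K ⊕ Kᗮ` splits `φ` into two vector functionals.
  have hcross : ∀ a, ⟪y, ρ a x⟫_ℂ = 0 := fun a =>
    Submodule.inner_left_of_mem_orthogonal (hinv a x hxK) hyK
  have hcross' : ∀ a, ⟪x, ρ a y⟫_ℂ = 0 := fun a =>
    Submodule.inner_right_of_mem_orthogonal hxK (hinv' a y hyK)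
  have hdec : ∀ a, φ a = ⟪x, ρ a x⟫_ℂ + ⟪y, ρ a y⟫_ℂ := by
    intro a
    rw [hφ]
    rw [show ⟪ξ, ρ a ξ⟫_ℂ = ⟪x + y, ρ a (x + y)⟫_ℂ by rw [← hsum], map_add, inner_add_left,
      inner_add_right, inner_add_right, hcross, hcross']
    ring
  have hscale : ∀ v : H, v ≠ 0 → ∀ a,
      ⟪v, ρ a v⟫_ℂ = ((‖v‖ ^ 2 : ℝ) : ℂ) * vectorFunctional ρ (((‖v‖⁻¹ : ℝ) : ℂ) • v) a := by
    intro v hv a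
    have hv' : ((‖v‖ : ℝ) : ℂ) ≠ 0 := by
      rw [Complex.ofReal_ne_zero]
      exact norm_ne_zero_iff.2 hv
    rw [vectorFunctional_apply, map_smul, inner_smul_left, inner_smul_right, Complex.conj_ofReal]
    push_cast
    field_simp
  have hunit : ∀ v : H, v ≠ 0 → ‖((‖v‖⁻¹ : ℝ) : ℂ) • v‖ = 1 := by
    intro v hv
    rw [norm_smul, Complex.norm_real, norm_inv, norm_norm]
    exact inv_mul_cancel₀ (norm_ne_zero_iff.2 hv)
  set φ₁ := vectorFunctional ρ (((‖x‖⁻¹ : ℝ) : ℂ) • x)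
  set φ₂ := vectorFunctional ρ (((‖y‖⁻¹ : ℝ) : ℂ) • y)
  have h₁S : φ₁ ∈ stateSpace B := vectorFunctional_mem_stateSpace ρ (hunit x hx0)
  have h₂S : φ₂ ∈ stateSpace B := vectorFunctional_mem_stateSpace ρ (hunit y hy0)
  have hdec' : ∀ a, φ a = ((‖x‖ ^ 2 : ℝ) : ℂ) * φ₁ a + ((‖y‖ ^ 2 : ℝ) : ℂ) * φ₂ a := by
    intro a
    rw [hdec, hscale x hx0, hscale y hy0]
  have hxpos : 0 < ‖x‖ ^ 2 := by positivity
  have hypos : 0 < ‖y‖ ^ 2 := by positivity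
  have hone : ‖x‖ ^ 2 + ‖y‖ ^ 2 = 1 := by
    have h := hdec' 1
    rw [hφS.2, h₁S.2, h₂S.2, mul_one, mul_one] at h
    exact_mod_cast h.symm
  have hzero : ∀ n, φ₁ (d n) = 0 ∧ φ₂ (d n) = 0 := by
    intro n
    have h := hdec' (d n)
    rw [hφd n, eq_comm, add_eq_zero_iff_of_nonneg
      (mul_nonneg (Complex.zero_le_real.2 hxpos.le) (h₁S.1 _ (hd n)))
      (mul_nonneg (Complex.zero_le_real.2 hypos.le) (h₂S.1 _ (hd n)))] at h
    have hx' : ((‖x‖ ^ 2 : ℝ) : ℂ) ≠ 0 := Complex.ofReal_ne_zero.2 hxpos.ne'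
    have hy' : ((‖y‖ ^ 2 : ℝ) : ℂ) ≠ 0 := Complex.ofReal_ne_zero.2 hypos.ne'
    exact ⟨(mul_eq_zero.1 h.1).resolve_left hx', (mul_eq_zero.1 h.2).resolve_left hy'⟩
  have heq : φ₁ = φ := by
    refine (mem_extremePoints_iff_left.1 hext).2 φ₁ ⟨h₁S, fun n => (hzero n).1⟩ φ₂
      ⟨h₂S, fun n => (hzero n).2⟩ ⟨‖x‖ ^ 2, ‖y‖ ^ 2, hxpos, hypos, hone, ?_⟩
    refine DFunLike.ext _ _ fun a => ?_
    rw [hdec' a]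
    rfl
  -- Equality of `φ₁` and `φ` forces `x` to be a multiple of the cyclic vector, so that `ξ ∈ K`.
  have hort : ∀ z : H, ⟪z, x - ((‖x‖ ^ 2 : ℝ) : ℂ) • ξ⟫_ℂ = 0 := by
    refine fun z => hcyc.induction_on
      (p := fun z => ⟪z, x - ((‖x‖ ^ 2 : ℝ) : ℂ) • ξ⟫_ℂ = 0) z
      (isClosed_eq (by fun_prop) continuous_const) fun a => ?_
    have h1 : ⟪ξ, ρ (star a) x⟫_ℂ = ((‖x‖ ^ 2 : ℝ) : ℂ) * ⟪ξ, ρ (star a) ξ⟫_ℂ := by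
      have h2 := hscale x hx0 (star a)
      change _ = _ * φ₁ (star a) at h2
      rw [heq, hφ] at h2
      rw [← h2]
      nth_rewrite 1 [hsum]
      rw [inner_add_left, hcross, add_zero]
    rw [map_star, ContinuousLinearMap.star_eq_adjoint, ContinuousLinearMap.adjoint_inner_right,
      ContinuousLinearMap.adjoint_inner_right] at h1
    rw [inner_sub_right, inner_smul_right]
    exact sub_eq_zero.2 h1
  have hx1 : x = ((‖x‖ ^ 2 : ℝ) : ℂ) • ξ := sub_eq_zero.1 (inner_self_eq_zero.1 (hort _))
  have hξK : ξ ∈ K := by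
    have hne : ((‖x‖ ^ 2 : ℝ) : ℂ) ≠ 0 := Complex.ofReal_ne_zero.2 hxpos.ne'
    have := K.smul_mem (((‖x‖ ^ 2 : ℝ) : ℂ)⁻¹) hxK
    rwa [show (((‖x‖ ^ 2 : ℝ) : ℂ)⁻¹) • x = ξ from inv_smul_eq_iff₀ hne |>.2 hx1] at this
  apply hy0
  rw [hy, hx, K.starProjection_eq_self_iff.2 hξK, sub_self]

end GNS

section Exhaustion

variable {B : Type u} [CStarAlgebra B] [PartialOrder B] [StarOrderedRing B]

/-- In a separable C*-algebra, countably many nonzero elements detect the injectivity of all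
representations. They are the nonzero ones among the elements `(aₙ - 1/4)₊`, where `aₙ` is a dense
sequence of selfadjoint elements: a nonzero kernel contains a positive element of norm one, and
those `aₙ` that are close to it are mapped to elements of norm less than `1/4`. -/
theorem exists_seq_detecting_injective [Nontrivial B] [TopologicalSpace.SeparableSpace B] :
    ∃ e : ℕ → B, (∀ n, e n ≠ 0) ∧
      ∀ (H : Type v) [NormedAddCommGroup H] [InnerProductSpace ℂ H] [CompleteSpace H]
        (ρ : B →⋆ₐ[ℂ] (H →L[ℂ] H)), (∀ n, ρ (e n) ≠ 0) → Function.Injective ρ := by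
  have : SecondCountableTopology B := UniformSpace.secondCountable_of_separable B
  obtain ⟨a, ha⟩ := TopologicalSpace.exists_dense_seq (selfAdjoint B)
  let f : ℝ → ℝ := fun t => max (t - 1 / 4) 0
  have hf : Continuous f := by fun_prop
  let g : ℕ → B := fun n => cfc f (a n : B)
  classical
  refine ⟨fun n => if g n = 0 then 1 else g n, fun n => ?_, ?_⟩
  · dsimp only
    split_ifs with h
    · exact one_ne_zero
    · exact h
  intro H _ _ _ ρ hρ
  rw [injective_iff_map_eq_zero]
  intro x hx
  by_contra hx0
  set r : ℝ := ‖star x * x‖ with hr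
  have hr0 : r ≠ 0 := by
    rw [hr, CStarRing.norm_star_mul_self]
    simpa using hx0
  have hrpos : 0 < r := lt_of_le_of_ne (norm_nonneg _) hr0.symm
  set b : B := r⁻¹ • (star x * x) with hb
  have hb0 : 0 ≤ b := smul_nonneg (inv_nonneg.2 hrpos.le) (star_mul_self_nonneg x)
  have hb1 : ‖b‖ = 1 := by
    rw [hb, norm_smul, norm_inv, Real.norm_of_nonneg hrpos.le, ← hr, inv_mul_cancel₀ hr0]
  have hρb : ρ b = 0 := by
    rw [hb, ← Complex.coe_smul, map_smul, map_mul, hx, mul_zero, smul_zero]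
  obtain ⟨n, hn⟩ := ha.exists_dist_lt ⟨b, IsSelfAdjoint.of_nonneg hb0⟩
    (show (0 : ℝ) < 1 / 4 by norm_num)
  have hn' : ‖b - (a n : B)‖ < 1 / 4 := by
    rw [Subtype.dist_eq, dist_eq_norm] at hn
    exact hn
  have hsa : IsSelfAdjoint (a n : B) := (a n).2
  have hg0 : g n ≠ 0 := by
    intro hg
    have h1 : (spectrum ℝ (a n : B)).EqOn f (fun _ => 0) := by
      rw [← cfc_eq_cfc_iff_eqOn (a := (a n : B)) hsa hf.continuousOn continuousOn_const]
      rw [cfc_const_zero]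
      exact hg
    have h2 : (a n : B) ≤ algebraMap ℝ B (1 / 4) := by
      refine le_algebraMap_of_spectrum_le (fun t ht => ?_) hsa
      have := h1 ht
      have h3 : t - 1 / 4 ≤ f t := le_max_left _ _
      simp only at this
      linarith
    have h3 : b - (a n : B) ≤ algebraMap ℝ B (1 / 4) :=
      (IsSelfAdjoint.le_algebraMap_norm_self ((IsSelfAdjoint.of_nonneg hb0).sub hsa)).trans
        (algebraMap_mono B hn'.le)
    have h4 : b ≤ algebraMap ℝ B (1 / 2) := by
      have := add_le_add h2 h3
      rw [add_sub_cancel, ← map_add] at this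
      norm_num at this ⊢
      exact this
    have h5 := (CStarAlgebra.norm_le_iff_le_algebraMap b (by norm_num) hb0).2 h4
    rw [hb1] at h5
    norm_num at h5
  apply hρ n
  dsimp only
  rw [if_neg hg0]
  have hcont : Continuous ρ := map_continuous ρ
  change ρ (cfc f (a n : B)) = 0
  rw [StarAlgHomClass.map_cfc (S := ℂ) ρ f (a n : B) hf.continuousOn hcont hsa (hsa.map ρ)]
  rw [← cfc_const_zero ℝ (ρ (a n : B))]
  refine cfc_congr fun t ht => ?_
  have h1 := spectrum.norm_le_norm_mul_of_mem ht
  have h2 : ‖ρ (a n : B)‖ < 1 / 4 := by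
    have : ρ (a n : B) = - ρ (b - a n) := by rw [map_sub, hρb, zero_sub, neg_neg]
    rw [this, norm_neg]
    exact (NonUnitalStarAlgHom.norm_apply_le ρ _).trans_lt hn'
  have h3 : ‖(1 : H →L[ℂ] H)‖ ≤ 1 := ContinuousLinearMap.norm_id_le
  have h4 : t ≤ ‖t‖ := Real.le_norm_self t
  refine max_eq_right ?_
  nlinarith [norm_nonneg (ρ (a n : B))]

/-- The inductive step in the construction of a pure state not vanishing on given ideals: inside
the hereditary subalgebra where `d` lives, there is a positive contraction `c` in the ideal
generated by `e` which acts as the identity on some nonzero `d'`. For a nonzero `y = d x e`,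
normalized so that `h = y y*` has norm one, `c = min (2h, 1)` and `d' = (h - 1/2)₊` will do. -/
theorem exists_contraction_of_prime
    (hprime : ∀ a b : B, (∀ x, a * x * b = 0) → a = 0 ∨ b = 0) {d e : B} (hd : d ≠ 0)
    (he : e ≠ 0) :
    ∃ c d' : B, d' ≠ 0 ∧ 0 ≤ c ∧ c ≤ 1 ∧ c * d' = d' ∧ (∀ z, z * d = d → z * c = c) ∧
      ∃ s t, c = s * e * t := by
  obtain ⟨x, hx⟩ : ∃ x, d * x * e ≠ 0 := by
    by_contra! h
    exact (hprime d e h).elim hd he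
  have : Nontrivial B := ⟨⟨d, 0, hd⟩⟩
  set y := d * x * e with hy
  set r : ℝ := ‖y * star y‖ with hr
  have hr0 : r ≠ 0 := by
    rw [hr, CStarRing.norm_self_mul_star]
    simpa using hx
  have hrpos : 0 < r := lt_of_le_of_ne (norm_nonneg _) hr0.symm
  set h : B := r⁻¹ • (y * star y) with hh
  have hh0 : 0 ≤ h := smul_nonneg (inv_nonneg.2 hrpos.le) (mul_star_self_nonneg y)
  have hh1 : ‖h‖ = 1 := by
    rw [hh, norm_smul, norm_inv, Real.norm_of_nonneg hrpos.le, ← hr, inv_mul_cancel₀ hr0]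
  have hsa : IsSelfAdjoint h := .of_nonneg hh0
  let g : ℝ → ℝ := fun t => (max t (1 / 2))⁻¹
  have hg : Continuous g := by
    refine Continuous.inv₀ (by fun_prop) fun t => ?_
    have : (1 / 2 : ℝ) ≤ max t (1 / 2) := le_max_right _ _
    linarith
  let k : ℝ → ℝ := fun t => max (t - 1 / 2) 0
  have hk : Continuous k := by fun_prop
  have hc : cfc (fun t => t * g t) h = h * cfc g h := by
    rw [cfc_mul (fun t => t) g h continuousOn_id hg.continuousOn, cfc_id' ℝ h]
  refine ⟨cfc (fun t => t * g t) h, cfc k h, ?_, ?_, ?_, ?_, ?_, ?_⟩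
  · intro h0
    have h1 : (spectrum ℝ h).EqOn k (fun _ => 0) := by
      rw [← cfc_eq_cfc_iff_eqOn (a := h) hsa hk.continuousOn continuousOn_const]
      rw [cfc_const_zero]
      exact h0
    have h2 := h1 (CStarAlgebra.norm_mem_spectrum_of_nonneg hh0)
    rw [hh1] at h2
    norm_num [k] at h2
  · refine cfc_nonneg fun t ht => ?_
    have ht0 : 0 ≤ t := spectrum_nonneg_of_nonneg hh0 ht
    positivity
  · refine cfc_le_one _ _ fun t ht => ?_
    have h1 : (0 : ℝ) < max t (1 / 2) := lt_of_lt_of_le (by norm_num) (le_max_right _ _)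
    rw [← div_eq_mul_inv, div_le_one h1]
    exact le_max_left _ _
  · rw [← cfc_mul (fun t => t * g t) k h (continuous_id.mul hg).continuousOn hk.continuousOn]
    refine cfc_congr fun t _ => ?_
    rcases le_total t (1 / 2) with ht | ht
    · have : k t = 0 := max_eq_right (by linarith)
      simp [this]
    · have : g t = t⁻¹ := by simp only [g, max_eq_left ht]
      simp only [this]
      rw [mul_inv_cancel₀ (by linarith), one_mul]
  · intro z hz
    rw [hc, ← mul_assoc]
    congr 1
    rw [hh, mul_smul_comm, hy, ← mul_assoc, ← mul_assoc, ← mul_assoc, hz]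
  · refine ⟨r⁻¹ • (d * x), star y * cfc g h, ?_⟩
    rw [hc]
    nth_rewrite 1 [hh]
    rw [hy]
    simp only [smul_mul_assoc, mul_assoc]

end Exhaustion

variable {B : Type u} [CStarAlgebra B]

/-- A unital separable prime C*-algebra is primitive. The algebra is assumed to act faithfully on
some Hilbert space; vectors of this space provide the states from which a suitable pure state is
obtained by the Krein-Milman theorem. -/
theorem exists_injective_irreducible_of_prime [Nontrivial B] [TopologicalSpace.SeparableSpace B]
    (hprime : ∀ a b : B, (∀ x, a * x * b = 0) → a = 0 ∨ b = 0)
    {L : Type v} [NormedAddCommGroup L] [InnerProductSpace ℂ L] [CompleteSpace L]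
    (ι : B →⋆ₐ[ℂ] (L →L[ℂ] L)) (hι : Function.Injective ι) :
    ∃ (H : Type u) (_ : NormedAddCommGroup H) (_ : InnerProductSpace ℂ H) (_ : CompleteSpace H)
      (ρ : B →⋆ₐ[ℂ] (H →L[ℂ] H)), Function.Injective ρ ∧
      ∀ K : Submodule ℂ H, IsClosed (K : Set H) → (∀ a : B, ∀ v ∈ K, ρ a v ∈ K) →
        K = ⊥ ∨ K = ⊤ := by
  let _ : PartialOrder B := CStarAlgebra.spectralOrder B
  have : StarOrderedRing B := CStarAlgebra.spectralOrderedRing B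
  obtain ⟨e, he, hdetect⟩ := exists_seq_detecting_injective.{u, u} (B := B)
  choose! c d' hd' hc0 hc1 hcd hz hst using
    fun (d e : B) (hd : d ≠ 0) (he : e ≠ 0) => exists_contraction_of_prime hprime hd he
  let D : ℕ → B := fun n => Nat.rec 1 (fun n d => d' d (e n)) n
  have hDs : ∀ n, D (n + 1) = d' (D n) (e n) := fun n => rfl
  have hD : ∀ n, D n ≠ 0 := by
    intro n
    induction n with
    | zero => exact one_ne_zero
    | succ n ih => exact hd' _ _ ih (he n)
  let C : ℕ → B := fun n => c (D n) (e n)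
  have hCD : ∀ n m, m ≤ n → C m * D (n + 1) = D (n + 1) := by
    intro n
    induction n with
    | zero =>
      intro m hm
      obtain rfl : m = 0 := by omega
      exact hcd _ _ (hD 0) (he 0)
    | succ n ih =>
      intro m hm
      have hself : C (n + 1) * D (n + 2) = D (n + 2) := hcd _ _ (hD (n + 1)) (he _)
      rcases Nat.lt_or_ge n m with h | h
      · obtain rfl : m = n + 1 := by omega
        exact hself
      · have h1 : C m * C (n + 1) = C (n + 1) := hz _ _ (hD (n + 1)) (he _) _ (ih m h)
        rw [← hself, ← mul_assoc, h1]
  have hpos : ∀ n, 0 ≤ 1 - C n := fun n => sub_nonneg.2 (hc1 _ _ (hD n) (he n))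
  -- Unit vectors in the range of `D (n + 1)` give states taking the value `1` at `C 0, …, C n`.
  have hne : ∀ n, (stateFace fun m : Fin (n + 1) => 1 - C m).Nonempty := by
    intro n
    have h1 : ι (D (n + 1)) ≠ 0 := (map_ne_zero_iff ι hι).2 (hD (n + 1))
    obtain ⟨w, hw⟩ : ∃ w, ι (D (n + 1)) w ≠ 0 := by
      by_contra! h
      exact h1 (ContinuousLinearMap.ext h)
    set v := ι (D (n + 1)) w
    refine ⟨vectorFunctional ι (((‖v‖⁻¹ : ℝ) : ℂ) • v), vectorFunctional_mem_stateSpace ι ?_, ?_⟩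
    · rw [norm_smul, Complex.norm_real, norm_inv, norm_norm]
      exact inv_mul_cancel₀ (norm_ne_zero_iff.2 hw)
    · intro m
      have h2 : ι (1 - C m) v = 0 := by
        change (ι (1 - C m) * ι (D (n + 1))) w = 0
        rw [← map_mul, sub_mul, one_mul, hCD n m (by omega), sub_self, map_zero]
        rfl
      rw [vectorFunctional_apply, map_smul, h2, smul_zero, inner_zero_right]
  have hF : (stateFace fun m => 1 - C m).Nonempty := by
    have h := IsCompact.nonempty_iInter_of_sequence_nonempty_isCompact_isClosed
      (fun n => stateFace fun m : Fin (n + 1) => 1 - C m)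
      (fun n φ hφ => ⟨hφ.1, fun m => hφ.2 m.castSucc⟩) hne (isCompact_stateFace _)
      fun n => isClosed_stateFace _
    obtain ⟨φ, hφ⟩ := h
    rw [Set.mem_iInter] at hφ
    exact ⟨φ, (hφ 0).1, fun n => (hφ n).2 (Fin.last n)⟩
  have : LocallyConvexSpace ℝ (WeakDual ℂ B) :=
    inferInstanceAs (LocallyConvexSpace ℝ (WeakBilin (topDualPairing ℂ B)))
  -- By Krein-Milman, the face of states taking the value `1` at all `C n` contains a pure state.
  obtain ⟨φ, hφ⟩ := (isCompact_stateFace fun m => 1 - C m).extremePoints_nonempty hF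
  set f := positiveOfState φ hφ.1.1
  have hvec : vectorFunctional f.gnsStarAlgHom (gnsVector f) = φ :=
    DFunLike.ext _ _ fun a => inner_gnsVector f a
  refine ⟨f.GNS, inferInstance, inferInstance, inferInstance, f.gnsStarAlgHom, ?_, ?_⟩
  · refine hdetect _ _ fun n hn => ?_
    have h1 : f.gnsStarAlgHom (C n) = 0 := by
      obtain ⟨s, t, hst'⟩ := hst _ _ (hD n) (he n)
      change f.gnsStarAlgHom (c (D n) (e n)) = 0
      rw [hst', map_mul, map_mul, hn, mul_zero, zero_mul]
    have h2 : φ (C n) = 0 := by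
      rw [← hvec, vectorFunctional_apply, h1, zero_apply, inner_zero_right]
    have h3 := hφ.1.2 n
    rw [map_sub, h2, hφ.1.1.2, sub_zero] at h3
    exact one_ne_zero h3
  · rw [← hvec] at hφ
    exact eq_bot_or_eq_top_of_mem_extremePoints hpos f.gnsStarAlgHom (denseRange_gnsVector f) hφ

end SeparablePrime

/-! ### The dual of `L¹` -/

section DualL1

variable {α : Type*} [MeasurableSpace α]

/-- The inclusion `L²(μ) → L¹(μ)` for a finite measure `μ`. -/
def lpTwoToLpOne (μ : Measure α) [IsFiniteMeasure μ] : Lp ℝ 2 μ →L[ℝ] Lp ℝ 1 μ :=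
  LinearMap.mkContinuous
    { toFun := fun u => ((Lp.memLp u).mono_exponent (by norm_num : (1 : ℝ≥0∞) ≤ 2)).toLp u
      map_add' := fun u v => by
        rw [← MemLp.toLp_add]
        exact MemLp.toLp_congr _ _ (Lp.coeFn_add u v)
      map_smul' := fun c u => by
        rw [RingHom.id_apply, ← MemLp.toLp_const_smul]
        exact MemLp.toLp_congr _ _ (Lp.coeFn_smul c u) }
    ((μ Set.univ ^ (1 / (1 : ℝ≥0∞).toReal - 1 / (2 : ℝ≥0∞).toReal)).toReal) fun u => by
      rw [mul_comm]
      change ‖((Lp.memLp u).mono_exponent (by norm_num : (1 : ℝ≥0∞) ≤ 2)).toLp u‖ ≤ _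
      rw [Lp.norm_toLp, Lp.norm_def, ← ENNReal.toReal_mul]
      refine ENNReal.toReal_mono ?_
        (eLpNorm_le_eLpNorm_mul_rpow_measure_univ (by norm_num) (Lp.aestronglyMeasurable u))
      refine ENNReal.mul_ne_top (Lp.eLpNorm_ne_top u) (ENNReal.rpow_ne_top_of_nonneg ?_ ?_)
      · norm_num
      · exact measure_ne_top μ _

theorem lpTwoToLpOne_coeFn (μ : Measure α) [IsFiniteMeasure μ] (u : Lp ℝ 2 μ) :
    lpTwoToLpOne μ u =ᵐ[μ] u :=
  ((Lp.memLp u).mono_exponent (by norm_num : (1 : ℝ≥0∞) ≤ 2)).coeFn_toLp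

theorem integrable_memLp_top_mul {μ : Measure α} {φ : α → ℝ} (hφ : MemLp φ ∞ μ) (k : Lp ℝ 1 μ) :
    Integrable (fun x => φ x * k x) μ :=
  (L1.integrable_coeFn k).mul_of_top_right hφ

/-- Integration against an essentially bounded function, as a functional on `L¹`. -/
def integralMulL1 {μ : Measure α} {φ : α → ℝ} (hφ : MemLp φ ∞ μ) : Lp ℝ 1 μ →L[ℝ] ℝ :=
  LinearMap.mkContinuous
    { toFun := fun k => ∫ x, φ x * k x ∂μ
      map_add' := fun k l => by
        rw [← integral_add (integrable_memLp_top_mul hφ k) (integrable_memLp_top_mul hφ l)]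
        refine integral_congr_ae ?_
        filter_upwards [Lp.coeFn_add k l] with x hx
        rw [hx, Pi.add_apply, mul_add]
      map_smul' := fun c k => by
        rw [RingHom.id_apply, smul_eq_mul, ← integral_const_mul]
        refine integral_congr_ae ?_
        filter_upwards [Lp.coeFn_smul c k] with x hx
        rw [hx, Pi.smul_apply, smul_eq_mul]
        ring }
    (eLpNorm φ ∞ μ).toReal fun k => by
      rw [L1.norm_eq_integral_norm, ← integral_const_mul]
      refine norm_integral_le_of_norm_le ((L1.integrable_coeFn k).norm.const_mul _) ?_
      filter_upwards [ae_le_eLpNormEssSup (f := φ) (μ := μ)] with x hx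
      rw [norm_mul]
      refine mul_le_mul_of_nonneg_right ?_ (norm_nonneg _)
      rw [← eLpNorm_exponent_top] at hx
      have := ENNReal.toReal_mono hφ.2.ne hx
      simpa using this

theorem integralMulL1_apply {μ : Measure α} {φ : α → ℝ} (hφ : MemLp φ ∞ μ) (k : Lp ℝ 1 μ) :
    integralMulL1 hφ k = ∫ x, φ x * k x ∂μ := rfl

/-- For a finite measure, a bounded functional on `L¹` restricts to `L² ⊆ L¹`, where it is
represented by an `L²` function; this function is bounded by the norm of the functional. -/
theorem exists_memLp_top_of_dual_of_isFiniteMeasure {μ : Measure α} [IsFiniteMeasure μ]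
    (Φ : Lp ℝ 1 μ →L[ℝ] ℝ) :
    ∃ φ : α → ℝ, MemLp φ ∞ μ ∧ ∀ k : Lp ℝ 1 μ, Φ k = ∫ x, φ x * k x ∂μ := by
  set φ : Lp ℝ 2 μ := (InnerProductSpace.toDual ℝ (Lp ℝ 2 μ)).symm (Φ ∘L lpTwoToLpOne μ) with hφ
  have hind : ∀ {s : Set α} (hs : MeasurableSet s),
      Φ (indicatorConstLp 1 hs (measure_ne_top μ s) 1) = ∫ x in s, φ x ∂μ := by
    intro s hs
    rw [← L2.inner_indicatorConstLp_one (𝕜 := ℝ) hs (measure_ne_top μ s) φ, real_inner_comm, hφ,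
      InnerProductSpace.toDual_symm_apply, ContinuousLinearMap.comp_apply]
    congr 1
    apply Lp.ext
    refine indicatorConstLp_coeFn.trans ?_
    exact indicatorConstLp_coeFn.symm.trans (lpTwoToLpOne_coeFn μ _).symm
  have hint : Integrable φ μ := (Lp.memLp φ).integrable (by norm_num)
  have hbound : ∀ {s : Set α}, MeasurableSet s → |∫ x in s, φ x ∂μ| ≤ ∫ _x in s, ‖Φ‖ ∂μ := by
    intro s hs
    rw [← hind hs, ← Real.norm_eq_abs]
    refine (Φ.le_opNorm _).trans ?_
    rw [norm_indicatorConstLp one_ne_zero ENNReal.one_ne_top, integral_const]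
    simp [mul_comm]
  have hle : ∀ᵐ x ∂μ, φ x ≤ ‖Φ‖ :=
    ae_le_of_forall_setIntegral_le hint (integrable_const _) fun s hs _ =>
      (abs_le.1 (hbound hs)).2
  have hge : ∀ᵐ x ∂μ, -‖Φ‖ ≤ φ x :=
    ae_le_of_forall_setIntegral_le (integrable_const _) hint fun s hs _ => by
      rw [integral_neg]
      exact (abs_le.1 (hbound hs)).1
  have hmem : MemLp φ ∞ μ := by
    refine memLp_top_of_bound (Lp.aestronglyMeasurable φ) ‖Φ‖ ?_
    filter_upwards [hle, hge] with x h1 h2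
    exact abs_le.2 ⟨h2, h1⟩
  refine ⟨φ, hmem, fun k => ?_⟩
  rw [← integralMulL1_apply hmem]
  refine Lp.induction ENNReal.one_ne_top (fun k => Φ k = integralMulL1 hmem k) ?_ ?_ ?_ k
  · intro c s hs hμs
    have h : (Lp.simpleFunc.indicatorConst 1 hs hμs.ne c : Lp ℝ 1 μ) =
        c • indicatorConstLp 1 hs hμs.ne (1 : ℝ) := by
      rw [Lp.simpleFunc.coe_indicatorConst]
      apply Lp.ext
      filter_upwards [indicatorConstLp_coeFn (p := 1) (hs := hs) (hμs := hμs.ne) (c := c),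
        Lp.coeFn_smul c (indicatorConstLp 1 hs hμs.ne (1 : ℝ)),
        indicatorConstLp_coeFn (p := 1) (hs := hs) (hμs := hμs.ne) (c := (1 : ℝ))] with x h1 h2 h3
      rw [h1, h2, Pi.smul_apply, h3]
      by_cases hx : x ∈ s <;> simp [hx]
    rw [h, map_smul, map_smul, hind hs, integralMulL1_apply, ← integral_indicator hs]
    congr 1
    refine integral_congr_ae ?_
    filter_upwards [indicatorConstLp_coeFn (p := 1) (hs := hs) (hμs := hμs.ne) (c := (1 : ℝ))]
      with x hx
    rw [hx]
    by_cases hx' : x ∈ s <;> simp [hx']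
  · intro f g hf hg _ h1 h2
    rw [map_add, map_add, h1, h2]
  · exact isClosed_eq Φ.continuous (integralMulL1 hmem).continuous

/-- For a σ-finite measure, every bounded functional on `L¹` is given by an essentially bounded
function. -/
theorem exists_memLp_top_of_dual {μ : Measure α} [SigmaFinite μ] (Φ : Lp ℝ 1 μ →L[ℝ] ℝ) :
    ∃ φ : α → ℝ, MemLp φ ∞ μ ∧ ∀ k : Lp ℝ 1 μ, Φ k = ∫ x, φ x * k x ∂μ := by
  obtain ⟨w, hw0, hwm, hw⟩ := exists_pos_lintegral_lt_of_sigmaFinite μ one_ne_zero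
  -- Pass to the equivalent finite measure `w μ`, for which `u ↦ w u` is an isometry of `L¹`.
  set ν := μ.withDensity fun x => (w x : ℝ≥0∞) with hν
  have : IsFiniteMeasure ν := isFiniteMeasure_withDensity (hw.trans ENNReal.one_lt_top).ne
  have hμν : μ ≪ ν := withDensity_absolutelyContinuous' hwm.coe_nnreal_ennreal.aemeasurable
    (Filter.Eventually.of_forall fun x => by simpa using (hw0 x).ne')
  obtain ⟨φ, hφ, hΦ⟩ := exists_memLp_top_of_dual_of_isFiniteMeasure
    (Φ ∘L (withDensitySMulLI μ (E := ℝ) hwm).toContinuousLinearMap)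
  refine ⟨φ, ?_, fun k => ?_⟩
  · have hb := ae_le_eLpNormEssSup (f := φ) (μ := ν)
    refine memLp_top_of_bound (hφ.1.mono_ac hμν) (eLpNorm φ ∞ ν).toReal ?_
    filter_upwards [hμν.ae_le hb] with x hx
    rw [← eLpNorm_exponent_top] at hx
    simpa using ENNReal.toReal_mono hφ.2.ne hx
  · have hk : Integrable (fun x => (w x : ℝ)⁻¹ * k x) ν := by
      rw [hν, integrable_withDensity_iff_integrable_smul hwm]
      refine (L1.integrable_coeFn k).congr (Filter.Eventually.of_forall fun x => ?_)
      have : (w x : ℝ) ≠ 0 := by simpa using (hw0 x).ne'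
      simp only [NNReal.smul_def, smul_eq_mul]
      field_simp
    have hku : withDensitySMulLI μ (E := ℝ) hwm (hk.toL1 _) = k := by
      rw [withDensitySMulLI_apply]
      apply Lp.ext
      refine (MemLp.coeFn_toLp _).trans ?_
      filter_upwards [hμν.ae_le hk.coeFn_toL1] with x hx
      have : (w x : ℝ) ≠ 0 := by simpa using (hw0 x).ne'
      rw [hx]
      simp only [NNReal.smul_def, smul_eq_mul]
      field_simp
    have h := hΦ (hk.toL1 _)
    rw [ContinuousLinearMap.comp_apply] at h
    change Φ (withDensitySMulLI μ (E := ℝ) hwm (hk.toL1 _)) = _ at h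
    rw [hku] at h
    rw [h]
    refine (integral_withDensity_eq_integral_smul hwm _).trans ?_
    refine integral_congr_ae ?_
    filter_upwards [hμν.ae_le hk.coeFn_toL1] with x hx
    have : (w x : ℝ) ≠ 0 := by simpa using (hw0 x).ne'
    rw [hx]
    simp only [NNReal.smul_def, smul_eq_mul]
    field_simp

theorem ae_eq_of_forall_integral_mul_eq {μ : Measure α} [SigmaFinite μ] {φ ψ : α → ℝ}
    (hφ : MemLp φ ∞ μ) (hψ : MemLp ψ ∞ μ)
    (h : ∀ k : Lp ℝ 1 μ, ∫ x, φ x * k x ∂μ = ∫ x, ψ x * k x ∂μ) : φ =ᵐ[μ] ψ := by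
  have key : ∀ {θ : α → ℝ} (_ : MemLp θ ∞ μ) (s : Set α) (hs : MeasurableSet s) (hμs : μ s < ∞),
      ∫ x, θ x * indicatorConstLp 1 hs hμs.ne (1 : ℝ) x ∂μ = ∫ x in s, θ x ∂μ := by
    intro θ _ s hs hμs
    rw [← integral_indicator hs]
    refine integral_congr_ae ?_
    filter_upwards [indicatorConstLp_coeFn (p := 1) (hs := hs) (hμs := hμs.ne) (c := (1 : ℝ))]
      with x hx
    rw [hx]
    by_cases hx' : x ∈ s <;> simp [hx']
  have hint : ∀ {θ : α → ℝ} (_ : MemLp θ ∞ μ) (s : Set α), MeasurableSet s → μ s < ∞ →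
      IntegrableOn θ s μ := by
    intro θ hθ s hs hμs
    have : IsFiniteMeasure (μ.restrict s) := ⟨by simpa using hμs⟩
    exact (hθ.restrict s).integrable le_top
  refine ae_eq_of_forall_setIntegral_eq_of_sigmaFinite (hint hφ) (hint hψ) fun s hs hμs => ?_
  rw [← key hφ s hs hμs, ← key hψ s hs hμs]
  exact h _

end DualL1

/-! ### Translations of `Lᵖ` -/

section Translations

variable {G : Type u} [Group G] [TopologicalSpace G] [IsTopologicalGroup G]
  [LocallyCompactSpace G] [T2Space G] [SecondCountableTopology G]
  [MeasurableSpace G] [BorelSpace G] (μ : Measure G) [μ.IsHaarMeasure]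
  (𝕜 : Type*) [NormedField 𝕜] {E : Type*} [NormedAddCommGroup E] [NormedSpace 𝕜 E]
  {p : ℝ≥0∞} [Fact (1 ≤ p)]

/-- The left translation `f ↦ f (g⁻¹ ·)` as a linear isometry of `Lᵖ(G, μ; E)`. -/
def translateLp (g : G) : Lp E p μ →ₗᵢ[𝕜] Lp E p μ :=
  Lp.compMeasurePreservingₗᵢ 𝕜 (fun x => g⁻¹ * x) (measurePreserving_mul_left μ g⁻¹)

theorem translateLp_eq_smul (g : G) (f : Lp E p μ) :
    translateLp μ 𝕜 g f = (DomMulAct.mk g⁻¹) • f := rfl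

theorem translateLp_coeFn (g : G) (f : Lp E p μ) :
    translateLp μ 𝕜 g f =ᵐ[μ] fun x => f (g⁻¹ * x) :=
  Lp.coeFn_compMeasurePreserving f (measurePreserving_mul_left μ g⁻¹)

theorem translateLp_one (f : Lp E p μ) : translateLp μ 𝕜 1 f = f := by
  rw [translateLp_eq_smul, inv_one, DomMulAct.mk_one, one_smul]

theorem translateLp_mul (g h : G) (f : Lp E p μ) :
    translateLp μ 𝕜 (g * h) f = translateLp μ 𝕜 g (translateLp μ 𝕜 h f) := by
  rw [translateLp_eq_smul, translateLp_eq_smul, translateLp_eq_smul, smul_smul,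
    ← DomMulAct.mk_mul, mul_inv_rev]

theorem continuous_translateLp (hp : p ≠ ∞) (f : Lp E p μ) :
    Continuous fun g : G => translateLp μ 𝕜 g f := by
  let _ : PseudoMetricSpace G := TopologicalSpace.pseudoMetrizableSpacePseudoMetric G
  have : Fact (p ≠ ∞) := ⟨hp⟩
  have : μ.InnerRegularCompactLTTop := inferInstance
  change Continuous fun g : G => (DomMulAct.mk g⁻¹) • f
  exact (DomMulAct.continuous_mk.comp continuous_inv).smul continuous_const

theorem continuous_translateLp_inv (hp : p ≠ ∞) (f : Lp E p μ) :
    Continuous fun g : G => translateLp μ 𝕜 g⁻¹ f :=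
  (continuous_translateLp μ 𝕜 hp f).comp continuous_inv

end Translations

/-! ### Averages of strongly continuous families of isometries -/

section Average

variable {G : Type u} [TopologicalSpace G] [SecondCountableTopology G]
  [MeasurableSpace G] [BorelSpace G] {μ : Measure G}
  {X : Type*} [NormedAddCommGroup X] [NormedSpace ℝ X]

theorem integrable_smul_apply {V : G → X →ₗᵢ[ℝ] X} (hV : ∀ k, Continuous fun y => V y k)
    (b : Lp ℝ 1 μ) (k : X) : Integrable (fun y => b y • V y k) μ := by
  have hb : Integrable b μ := L1.integrable_coeFn b
  refine (hb.norm.mul_const ‖k‖).mono'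
    (hb.aestronglyMeasurable.smul (hV k).aestronglyMeasurable) ?_
  exact Filter.Eventually.of_forall fun y => by
    rw [norm_smul, LinearIsometry.norm_map]

/-- The average `b ↦ (k ↦ ∫ b(y) V(y) k dμ(y))` of a strongly continuous family of isometries. -/
def averageL1 (V : G → X →ₗᵢ[ℝ] X) (hV : ∀ k, Continuous fun y => V y k) :
    Lp ℝ 1 μ →L[ℝ] (X →L[ℝ] X) :=
  LinearMap.mkContinuous₂
    (LinearMap.mk₂ ℝ (fun (b : Lp ℝ 1 μ) (k : X) => ∫ y, b y • V y k ∂μ)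
      (fun b₁ b₂ k => by
        rw [← integral_add (integrable_smul_apply hV b₁ k) (integrable_smul_apply hV b₂ k)]
        refine integral_congr_ae ?_
        filter_upwards [Lp.coeFn_add b₁ b₂] with x hx
        rw [hx, Pi.add_apply, add_smul])
      (fun c b k => by
        rw [← integral_smul]
        refine integral_congr_ae ?_
        filter_upwards [Lp.coeFn_smul c b] with x hx
        rw [hx, Pi.smul_apply, smul_assoc])
      (fun b k₁ k₂ => by
        rw [← integral_add (integrable_smul_apply hV b k₁) (integrable_smul_apply hV b k₂)]
        simp only [map_add, smul_add])
      (fun c b k => by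
        rw [← integral_smul]
        simp only [map_smul, smul_comm c]))
    1 (fun b k => by
      rw [one_mul]
      refine (norm_integral_le_integral_norm _).trans (le_of_eq ?_)
      rw [L1.norm_eq_integral_norm, ← integral_mul_const]
      exact integral_congr_ae (Filter.Eventually.of_forall fun x => by
        simp only [norm_smul, LinearIsometry.norm_map]))

theorem averageL1_apply (V : G → X →ₗᵢ[ℝ] X) (hV : ∀ k, Continuous fun y => V y k)
    (b : Lp ℝ 1 μ) (k : X) : averageL1 V hV b k = ∫ y, b y • V y k ∂μ := rfl

theorem norm_averageL1_le (V : G → X →ₗᵢ[ℝ] X) (hV : ∀ k, Continuous fun y => V y k)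
    (b : Lp ℝ 1 μ) : ‖averageL1 V hV b‖ ≤ ‖b‖ := by
  refine ContinuousLinearMap.opNorm_le_bound _ (norm_nonneg b) fun k => ?_
  rw [averageL1_apply]
  refine (norm_integral_le_integral_norm _).trans (le_of_eq ?_)
  rw [L1.norm_eq_integral_norm, ← integral_mul_const]
  exact integral_congr_ae (Filter.Eventually.of_forall fun x => by
    simp only [norm_smul, LinearIsometry.norm_map])

end Average

/-! ### Convolution operators on `L¹` -/

section Convolution

variable {G : Type u} [Group G] [TopologicalSpace G] [IsTopologicalGroup G]
  [LocallyCompactSpace G] [T2Space G] [SecondCountableTopology G]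
  [MeasurableSpace G] [BorelSpace G] (μ : Measure G) [μ.IsHaarMeasure]

/-- The convolution `b * k = ∫ b(y) (y k) dμ(y)` on the real `L¹(G, μ)`. -/
def convL1 : Lp ℝ 1 μ →L[ℝ] (Lp ℝ 1 μ →L[ℝ] Lp ℝ 1 μ) :=
  averageL1 (fun y => translateLp μ ℝ y) fun k => continuous_translateLp μ ℝ ENNReal.one_ne_top k

/-- The opposite average `k ↦ ∫ a(y) (y⁻¹ k) dμ(y)` on the real `L¹(G, μ)`. -/
def coconvL1 : Lp ℝ 1 μ →L[ℝ] (Lp ℝ 1 μ →L[ℝ] Lp ℝ 1 μ) :=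
  averageL1 (fun y => translateLp μ ℝ y⁻¹) fun k =>
    continuous_translateLp_inv μ ℝ ENNReal.one_ne_top k

theorem integral_translateLp_smul {F : Type*} [NormedAddCommGroup F] [NormedSpace ℝ F]
    (g : G) (b : Lp ℝ 1 μ) (f : G → F) :
    ∫ y, translateLp μ ℝ g b y • f y ∂μ = ∫ y, b y • f (g * y) ∂μ := by
  have h : ∫ y, translateLp μ ℝ g b y • f y ∂μ = ∫ y, b (g⁻¹ * y) • f y ∂μ := by
    refine integral_congr_ae ?_
    filter_upwards [translateLp_coeFn μ ℝ g b] with y hy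
    rw [hy]
  rw [h, ← integral_mul_left_eq_self _ g]
  simp only [inv_mul_cancel_left]

theorem translateLp_convL1 (g : G) (b k : Lp ℝ 1 μ) :
    translateLp μ ℝ g (convL1 μ b k) = convL1 μ (translateLp μ ℝ g b) k := by
  rw [convL1, averageL1_apply, averageL1_apply, integral_translateLp_smul]
  rw [← LinearIsometry.coe_toContinuousLinearMap, ← ContinuousLinearMap.integral_comp_comm]
  · simp only [map_smul, LinearIsometry.coe_toContinuousLinearMap, translateLp_mul]
  · exact integrable_smul_apply
      (fun k => continuous_translateLp μ ℝ ENNReal.one_ne_top k) b k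

theorem coconvL1_translateLp (h : G) (a k : Lp ℝ 1 μ) :
    coconvL1 μ a (translateLp μ ℝ h k) = coconvL1 μ (translateLp μ ℝ h⁻¹ a) k := by
  rw [coconvL1, averageL1_apply, averageL1_apply, integral_translateLp_smul]
  simp only [mul_inv_rev, inv_inv, translateLp_mul]

/-- Averaging by `a` on the left commutes with convolution by `k` on the right. -/
theorem coconvL1_convL1 (a b k : Lp ℝ 1 μ) :
    coconvL1 μ a (convL1 μ b k) = convL1 μ (coconvL1 μ a b) k := by
  rw [coconvL1, averageL1_apply, averageL1_apply]
  simp only [translateLp_convL1]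
  have hint : Integrable (fun y => a y • translateLp μ ℝ y⁻¹ b) μ :=
    integrable_smul_apply (X := Lp ℝ 1 μ) (V := fun y : G => translateLp μ ℝ (E := ℝ) (p := 1) y⁻¹)
      (fun k : Lp ℝ 1 μ => continuous_translateLp_inv μ ℝ ENNReal.one_ne_top k) a b
  have h := ((convL1 μ).flip k).integral_comp_comm hint
  refine Eq.trans (integral_congr_ae (Filter.Eventually.of_forall fun y => ?_)) h
  change _ = (convL1 μ).flip k (a y • translateLp μ ℝ y⁻¹ b)
  rw [map_smul]
  rfl

theorem exists_measurableSet_subset_nhds_one {U : Set G} (hU : U ∈ nhds (1 : G)) :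
    ∃ V ⊆ U, MeasurableSet V ∧ μ V ≠ 0 ∧ μ V ≠ ∞ := by
  obtain ⟨K, hK, hKU, hKc⟩ := local_compact_nhds hU
  exact ⟨K, hKU, hKc.measurableSet, (Measure.measure_pos_of_mem_nhds μ hK).ne',
    hKc.measure_lt_top.ne⟩

/-- Normalized indicators of small neighbourhoods of `1` are an approximate unit. -/
theorem exists_norm_coconvL1_sub_lt (b : Lp ℝ 1 μ) {ε : ℝ} (hε : 0 < ε) :
    ∃ a : Lp ℝ 1 μ, ‖coconvL1 μ a b - b‖ < ε := by
  have hcont : Continuous fun y : G => translateLp μ ℝ y⁻¹ b :=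
    continuous_translateLp_inv μ ℝ ENNReal.one_ne_top b
  have hU : {y : G | translateLp μ ℝ y⁻¹ b ∈ Metric.closedBall b (ε / 2)} ∈ nhds (1 : G) := by
    refine hcont.continuousAt.preimage_mem_nhds ?_
    rw [inv_one, translateLp_one]
    exact Metric.closedBall_mem_nhds b (half_pos hε)
  obtain ⟨V, hVU, hVm, hV0, hVt⟩ := exists_measurableSet_subset_nhds_one μ hU
  refine ⟨indicatorConstLp 1 hVm hVt ((μ.real V)⁻¹), ?_⟩
  have h : coconvL1 μ (indicatorConstLp 1 hVm hVt ((μ.real V)⁻¹)) b =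
      ⨍ y in V, translateLp μ ℝ y⁻¹ b ∂μ := by
    rw [setAverage_eq, coconvL1, averageL1_apply, ← integral_smul, ← integral_indicator hVm]
    refine integral_congr_ae ?_
    filter_upwards [indicatorConstLp_coeFn (p := 1) (hs := hVm) (hμs := hVt)
      (c := (μ.real V)⁻¹)] with y hy
    rw [hy]
    by_cases hyV : y ∈ V <;> simp [hyV]
  have hmem : ⨍ y in V, translateLp μ ℝ y⁻¹ b ∂μ ∈ Metric.closedBall b (ε / 2) := by
    refine (convex_closedBall b (ε / 2)).set_average_mem Metric.isClosed_closedBall hV0 hVt ?_ ?_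
    · exact (ae_restrict_iff' hVm).2 (Filter.Eventually.of_forall fun y hy => hVU hy)
    · have : IsFiniteMeasure (μ.restrict V) := ⟨by simpa using hVt.lt_top⟩
      refine Integrable.of_bound (C := ‖b‖) hcont.aestronglyMeasurable
        (Filter.Eventually.of_forall fun y => ?_)
      rw [LinearIsometry.norm_map]
  rw [← h, mem_closedBall_iff_norm] at hmem
  linarith

end Convolution

/-! ### Invariant means and almost invariant vectors -/

section Mean

section DualFunction

variable {α : Type*} [MeasurableSpace α] {μ : Measure α}

variable (μ) in
/-- The integral as a functional on the real `L¹(μ)`. -/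
def integralL1 : Lp ℝ 1 μ →L[ℝ] ℝ := integralMulL1 (memLp_top_const (1 : ℝ))

theorem integralL1_apply (k : Lp ℝ 1 μ) : integralL1 μ k = ∫ x, k x ∂μ := by
  rw [integralL1, integralMulL1_apply]
  simp only [one_mul]

theorem integralL1_eq_norm {k : Lp ℝ 1 μ} (hk : 0 ≤ k) : integralL1 μ k = ‖k‖ := by
  rw [integralL1_apply, L1.norm_eq_integral_norm]
  refine integral_congr_ae ?_
  filter_upwards [(Lp.coeFn_nonneg k).2 hk] with x hx
  exact (Real.norm_of_nonneg hx).symm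

variable [SigmaFinite μ]

/-- The essentially bounded function representing a functional on `L¹(μ)`. -/
def dualFunction (Φ : Lp ℝ 1 μ →L[ℝ] ℝ) : Lp ℝ ∞ μ :=
  (exists_memLp_top_of_dual Φ).choose_spec.1.toLp _

theorem integral_dualFunction_mul (Φ : Lp ℝ 1 μ →L[ℝ] ℝ) (k : Lp ℝ 1 μ) :
    ∫ x, dualFunction Φ x * k x ∂μ = Φ k := by
  rw [(exists_memLp_top_of_dual Φ).choose_spec.2 k]
  refine integral_congr_ae ?_
  filter_upwards [MemLp.coeFn_toLp (exists_memLp_top_of_dual Φ).choose_spec.1] with x hx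
  rw [dualFunction, hx]

theorem dualFunction_eq {Φ : Lp ℝ 1 μ →L[ℝ] ℝ} {ψ : Lp ℝ ∞ μ}
    (h : ∀ k : Lp ℝ 1 μ, ∫ x, ψ x * k x ∂μ = Φ k) : dualFunction Φ = ψ := by
  apply Lp.ext
  refine ae_eq_of_forall_integral_mul_eq (Lp.memLp _) (Lp.memLp _) fun k => ?_
  rw [integral_dualFunction_mul, h]

theorem dualFunction_add (Φ Ψ : Lp ℝ 1 μ →L[ℝ] ℝ) :
    dualFunction (Φ + Ψ) = dualFunction Φ + dualFunction Ψ := by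
  refine dualFunction_eq fun k => ?_
  rw [add_apply, ← integral_dualFunction_mul Φ, ← integral_dualFunction_mul Ψ,
    ← integral_add (integrable_memLp_top_mul (Lp.memLp _) k)
      (integrable_memLp_top_mul (Lp.memLp _) k)]
  refine integral_congr_ae ?_
  filter_upwards [Lp.coeFn_add (dualFunction Φ) (dualFunction Ψ)] with x hx
  rw [hx, Pi.add_apply, add_mul]

theorem dualFunction_smul (c : ℝ) (Φ : Lp ℝ 1 μ →L[ℝ] ℝ) :
    dualFunction (c • Φ) = c • dualFunction Φ := by
  refine dualFunction_eq fun k => ?_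
  rw [smul_apply, ← integral_dualFunction_mul Φ, smul_eq_mul,
    ← integral_const_mul]
  refine integral_congr_ae ?_
  filter_upwards [Lp.coeFn_smul c (dualFunction Φ)] with x hx
  rw [hx, Pi.smul_apply, smul_eq_mul, mul_assoc]

theorem dualFunction_nonneg {Φ : Lp ℝ 1 μ →L[ℝ] ℝ} (h : ∀ k, 0 ≤ k → 0 ≤ Φ k) :
    0 ≤ dualFunction Φ := by
  rw [← Lp.coeFn_nonneg]
  refine ae_nonneg_of_forall_setIntegral_nonneg_of_sigmaFinite ?_ ?_
  · intro s hs hμs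
    have : IsFiniteMeasure (μ.restrict s) := ⟨by simpa using hμs⟩
    exact ((Lp.memLp (dualFunction Φ)).restrict s).integrable le_top
  · intro s hs hμs
    have h0 : 0 ≤ indicatorConstLp 1 hs hμs.ne (1 : ℝ) := by
      rw [← Lp.coeFn_nonneg]
      filter_upwards [indicatorConstLp_coeFn (p := 1) (hs := hs) (hμs := hμs.ne) (c := (1 : ℝ))]
        with x hx
      rw [hx]
      exact Set.indicator_nonneg (fun _ _ => zero_le_one) x
    have h1 := h _ h0
    rw [← integral_dualFunction_mul] at h1
    rw [← integral_indicator hs]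
    refine h1.trans_eq (integral_congr_ae ?_)
    filter_upwards [indicatorConstLp_coeFn (p := 1) (hs := hs) (hμs := hμs.ne) (c := (1 : ℝ))]
      with x hx
    rw [hx]
    by_cases hx' : x ∈ s <;> simp [hx']

theorem dualFunction_integralL1 :
    dualFunction (integralL1 μ) = (memLp_top_const (1 : ℝ)).toLp (fun _ : α => (1 : ℝ)) := by
  refine dualFunction_eq fun k => ?_
  rw [integralL1_apply]
  refine integral_congr_ae ?_
  filter_upwards [MemLp.coeFn_toLp (memLp_top_const (μ := μ) (1 : ℝ))] with x hx
  rw [hx, one_mul]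

end DualFunction

variable {G : Type u} [Group G] [TopologicalSpace G] [IsTopologicalGroup G]
  [LocallyCompactSpace G] [T2Space G] [SecondCountableTopology G]
  [MeasurableSpace G] [BorelSpace G] {μ : Measure G} [μ.IsHaarMeasure]

theorem dualFunction_comp_translateLp (Φ : Lp ℝ 1 μ →L[ℝ] ℝ) (g : G) :
    dualFunction (Φ ∘L (translateLp μ ℝ g).toContinuousLinearMap) =
      Lp.compMeasurePreserving (fun x => g * x) (measurePreserving_mul_left μ g)
        (dualFunction Φ) := by
  refine dualFunction_eq fun k => ?_
  change _ = Φ (translateLp μ ℝ g k)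
  rw [← integral_dualFunction_mul]
  have h : ∫ x, dualFunction Φ x * translateLp μ ℝ g k x ∂μ =
      ∫ x, dualFunction Φ x * k (g⁻¹ * x) ∂μ := by
    refine integral_congr_ae ?_
    filter_upwards [translateLp_coeFn μ ℝ g k] with x hx
    rw [hx]
  rw [h, ← integral_mul_left_eq_self (fun x => dualFunction Φ x * k (g⁻¹ * x)) g]
  refine integral_congr_ae ?_
  filter_upwards [Lp.coeFn_compMeasurePreserving (dualFunction Φ) (measurePreserving_mul_left μ g)]
    with x hx
  rw [hx, inv_mul_cancel_left]
  rfl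

/-- An invariant mean, regarded as a functional on the dual of `L¹(G, μ)`. -/
theorem IsAmenableGroup.exists_dual_mean (h : IsAmenableGroup μ) :
    ∃ M : (Lp ℝ 1 μ →L[ℝ] ℝ) →L[ℝ] ℝ,
      (∀ Φ : Lp ℝ 1 μ →L[ℝ] ℝ, (∀ k, 0 ≤ k → 0 ≤ Φ k) → 0 ≤ M Φ) ∧
      M (integralL1 μ) = 1 ∧
      ∀ (g : G) (Φ : Lp ℝ 1 μ →L[ℝ] ℝ),
        M (Φ ∘L (translateLp μ ℝ g).toContinuousLinearMap) = M Φ := by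
  obtain ⟨m, hpos, hone, hinv⟩ := h
  let M₀ : (Lp ℝ 1 μ →L[ℝ] ℝ) →ₗ[ℝ] ℝ :=
    { toFun := fun Φ => m (dualFunction Φ)
      map_add' := fun Φ Ψ => by rw [dualFunction_add, map_add]
      map_smul' := fun c Φ => by rw [dualFunction_smul, map_smul, RingHom.id_apply] }
  have hM₀ : ∀ Φ : Lp ℝ 1 μ →L[ℝ] ℝ, (∀ k, 0 ≤ k → 0 ≤ Φ k) → 0 ≤ M₀ Φ := fun Φ hΦ =>
    hpos _ (dualFunction_nonneg hΦ)
  have hM₀1 : M₀ (integralL1 μ) = 1 := by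
    change m (dualFunction (integralL1 μ)) = 1
    rw [dualFunction_integralL1, hone]
  have hle : ∀ Φ : Lp ℝ 1 μ →L[ℝ] ℝ, M₀ Φ ≤ ‖Φ‖ := by
    intro Φ
    have h1 := hM₀ (‖Φ‖ • integralL1 μ - Φ) fun k hk => by
      rw [sub_apply, smul_apply, integralL1_eq_norm hk,
        smul_eq_mul, sub_nonneg]
      exact (le_abs_self _).trans (Φ.le_opNorm k)
    rw [map_sub, map_smul, hM₀1, smul_eq_mul, mul_one] at h1
    linarith
  refine ⟨M₀.mkContinuous 1 fun Φ => ?_, hM₀, hM₀1, fun g Φ => ?_⟩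
  · rw [one_mul, Real.norm_eq_abs, abs_le]
    refine ⟨?_, hle Φ⟩
    have h1 := hle (-Φ)
    rw [map_neg, norm_neg] at h1
    linarith
  · change m (dualFunction _) = m (dualFunction _)
    rw [dualFunction_comp_translateLp, hinv]

/-- An invariant mean vanishes on the functionals `Φ (b * ·)` with `∫ b = 0`. Up to a
small error, `b` may be replaced by its average `coconvL1 μ a b`. After that, `Φ (b * ·)` is the
integral over `b` of the translates of the functional `Ψ = Φ ∘ coconvL1 μ a`. As these translates
depend norm continuously on the group element, the mean may be taken under the integral. -/
theorem mean_comp_convL1_eq_zero {M : (Lp ℝ 1 μ →L[ℝ] ℝ) →L[ℝ] ℝ}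
    (hM : ∀ (g : G) (Φ : Lp ℝ 1 μ →L[ℝ] ℝ),
      M (Φ ∘L (translateLp μ ℝ g).toContinuousLinearMap) = M Φ)
    (Φ : Lp ℝ 1 μ →L[ℝ] ℝ) {b : Lp ℝ 1 μ} (hb : integralL1 μ b = 0) :
    M (Φ ∘L convL1 μ b) = 0 := by
  have key : ∀ a : Lp ℝ 1 μ, M (Φ ∘L convL1 μ (coconvL1 μ a b)) = 0 := by
    intro a
    let Ψ : Lp ℝ 1 μ →L[ℝ] ℝ := Φ ∘L coconvL1 μ a
    let F : G → (Lp ℝ 1 μ →L[ℝ] ℝ) := fun y =>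
      Ψ ∘L (translateLp μ ℝ y).toContinuousLinearMap
    have hF : F = fun y => Φ ∘L coconvL1 μ (translateLp μ ℝ y⁻¹ a) := by
      funext y
      ext k
      exact congrArg Φ (coconvL1_translateLp μ y a k)
    have hFc : Continuous F := by
      rw [hF]
      exact continuous_const.clm_comp ((coconvL1 μ).continuous.comp
        (continuous_translateLp_inv μ ℝ ENNReal.one_ne_top a))
    have hFb : ∀ y, ‖F y‖ ≤ ‖Ψ‖ := by
      intro y
      refine ContinuousLinearMap.opNorm_le_bound _ (norm_nonneg _) fun k => ?_
      refine (Ψ.le_opNorm _).trans_eq ?_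
      exact congrArg (‖Ψ‖ * ·) ((translateLp μ ℝ y).norm_map k)
    have hint : Integrable (fun y => b y • F y) μ := by
      have hbi : Integrable b μ := L1.integrable_coeFn b
      refine (hbi.norm.mul_const ‖Ψ‖).mono'
        (hbi.aestronglyMeasurable.smul hFc.aestronglyMeasurable)
        (Filter.Eventually.of_forall fun y => ?_)
      rw [norm_smul]
      exact mul_le_mul_of_nonneg_left (hFb y) (norm_nonneg _)
    have heq : Φ ∘L convL1 μ (coconvL1 μ a b) = ∫ y, b y • F y ∂μ := by
      ext k
      rw [ContinuousLinearMap.integral_apply hint, ContinuousLinearMap.comp_apply,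
        ← coconvL1_convL1, convL1, averageL1_apply]
      have h1 := Ψ.integral_comp_comm (integrable_smul_apply (μ := μ) (X := Lp ℝ 1 μ)
        (V := fun y : G => translateLp μ ℝ (E := ℝ) (p := 1) y)
        (fun k : Lp ℝ 1 μ => continuous_translateLp μ ℝ ENNReal.one_ne_top k) b k)
      refine h1.symm.trans (integral_congr_ae (Filter.Eventually.of_forall fun y => ?_))
      exact Ψ.map_smul (b y) _
    rw [heq, ← M.integral_comp_comm hint]
    have h2 : ∀ y, M (b y • F y) = b y * M Ψ := by
      intro y
      rw [map_smul, smul_eq_mul, hM y Ψ]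
    simp only [h2]
    rw [integral_mul_const, ← integralL1_apply, hb, zero_mul]
  by_contra hne
  have hpos : 0 < ‖M (Φ ∘L convL1 μ b)‖ := norm_pos_iff.2 hne
  set C := ‖M‖ * ‖Φ‖ + 1 with hC
  have hCpos : 0 < C := by positivity
  obtain ⟨a, ha⟩ := exists_norm_coconvL1_sub_lt μ b (div_pos hpos hCpos)
  have h1 : M (Φ ∘L convL1 μ b) = - M (Φ ∘L convL1 μ (coconvL1 μ a b - b)) := by
    rw [map_sub, ContinuousLinearMap.comp_sub, map_sub, key a, zero_sub, neg_neg]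
  have h2 : ‖M (Φ ∘L convL1 μ b)‖ ≤ ‖M‖ * ‖Φ‖ * ‖coconvL1 μ a b - b‖ := by
    rw [h1, norm_neg, mul_assoc]
    refine (M.le_opNorm _).trans (mul_le_mul_of_nonneg_left ?_ (norm_nonneg _))
    refine (ContinuousLinearMap.opNorm_comp_le _ _).trans
      (mul_le_mul_of_nonneg_left ?_ (norm_nonneg _))
    exact norm_averageL1_le _ _ _
  rw [lt_div_iff₀ hCpos] at ha
  nlinarith [norm_nonneg (coconvL1 μ a b - b)]

variable (μ) in
/-- The probability densities in `L¹(G, μ)`. -/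
def densities : Set (Lp ℝ 1 μ) := {k | 0 ≤ k ∧ integralL1 μ k = 1}

theorem convex_densities : Convex ℝ (densities μ) := by
  intro k hk l hl s t hs ht hst
  refine ⟨?_, ?_⟩
  · rw [← Lp.coeFn_nonneg]
    filter_upwards [(Lp.coeFn_nonneg k).2 hk.1, (Lp.coeFn_nonneg l).2 hl.1,
      Lp.coeFn_add (s • k) (t • l), Lp.coeFn_smul s k, Lp.coeFn_smul t l] with x h1 h2 h3 h4 h5
    rw [h3, Pi.add_apply, h4, h5]
    exact add_nonneg (mul_nonneg hs h1) (mul_nonneg ht h2)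
  · rw [map_add, map_smul, map_smul, hk.2, hl.2, smul_eq_mul, smul_eq_mul, mul_one, mul_one, hst]

theorem smul_mem_densities {k : Lp ℝ 1 μ} (hk : 0 ≤ k) (hk0 : k ≠ 0) :
    ‖k‖⁻¹ • k ∈ densities μ := by
  refine ⟨?_, ?_⟩
  · rw [← Lp.coeFn_nonneg]
    filter_upwards [(Lp.coeFn_nonneg k).2 hk, Lp.coeFn_smul ‖k‖⁻¹ k] with x h1 h2
    rw [h2]
    exact mul_nonneg (inv_nonneg.2 (norm_nonneg _)) h1
  · rw [map_smul, integralL1_eq_norm hk, smul_eq_mul, inv_mul_cancel₀ (norm_ne_zero_iff.2 hk0)]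

/-- In an amenable group, finitely many `b` with `∫ b = 0` are almost annihilated by convolution
with a suitable probability density. -/
theorem IsAmenableGroup.exists_density_norm_convL1_lt (h : IsAmenableGroup μ) {n : ℕ}
    {b : Fin n → Lp ℝ 1 μ} (hb : ∀ i, integralL1 μ (b i) = 0) {ε : ℝ} (hε : 0 < ε) :
    ∃ k ∈ densities μ, ∀ i, ‖convL1 μ (b i) k‖ < ε := by
  obtain ⟨M, hMpos, hM1, hMinv⟩ := h.exists_dual_mean
  let A : Lp ℝ 1 μ →L[ℝ] (Fin n → Lp ℝ 1 μ) := ContinuousLinearMap.pi fun i => convL1 μ (b i)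
  suffices h0 : (0 : Fin n → Lp ℝ 1 μ) ∈ closure (A '' densities μ) by
    obtain ⟨_, ⟨k, hk, rfl⟩, hlt⟩ := Metric.mem_closure_iff.1 h0 ε hε
    rw [dist_zero_left] at hlt
    exact ⟨k, hk, fun i => (norm_le_pi_norm (A k) i).trans_lt hlt⟩
  by_contra h0
  -- A functional separating `0` from the images of all densities is a sum `Ψ` of functionals
  -- `Φ (b i * ·)` that is at most `u < 0` on densities, although the mean vanishes at `Ψ`.
  obtain ⟨Θ, u, hΘ, hu⟩ := geometric_hahn_banach_closed_point
    ((convex_densities.linear_image A.toLinearMap).closure) isClosed_closure h0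
  rw [map_zero] at hu
  let Ψ : Lp ℝ 1 μ →L[ℝ] ℝ := Θ ∘L A
  have hΨ : Ψ = ∑ i, (Θ ∘L ContinuousLinearMap.single ℝ (fun _ => Lp ℝ 1 μ) i) ∘L
      convL1 μ (b i) := by
    ext k
    rw [sum_apply]
    exact (ContinuousLinearMap.sum_comp_single ℝ (fun _ => Lp ℝ 1 μ) Θ (A k)).symm
  have hMΨ : M Ψ = 0 := by
    rw [hΨ, map_sum]
    exact Finset.sum_eq_zero fun i _ => mean_comp_convL1_eq_zero hMinv _ (hb i)
  have hle := hMpos (u • integralL1 μ - Ψ) fun k hk => by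
    by_cases hk0 : k = 0
    · rw [hk0, map_zero]
    have h1 : Ψ (‖k‖⁻¹ • k) < u :=
      hΘ _ (subset_closure ⟨_, smul_mem_densities hk hk0, rfl⟩)
    have hkpos : 0 < ‖k‖ := norm_pos_iff.2 hk0
    rw [map_smul, smul_eq_mul, inv_mul_lt_iff₀ hkpos] at h1
    rw [sub_apply, smul_apply, integralL1_eq_norm hk,
      smul_eq_mul, sub_nonneg, mul_comm]
    exact h1.le
  rw [map_sub, map_smul, hM1, hMΨ, smul_eq_mul, mul_one, sub_zero] at hle
  linarith

end Mean

/-! ### Almost invariant vectors in `L²` -/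

section SquareRoot

open Filter Topology

variable {α : Type*} [MeasurableSpace α] {μ : Measure α}

theorem norm_sq_eq_integral_norm_sq {E : Type*} [NormedAddCommGroup E] (f : Lp E 2 μ) :
    ‖f‖ ^ 2 = ∫ x, ‖f x‖ ^ 2 ∂μ := by
  rw [Lp.norm_def, (Lp.memLp f).eLpNorm_eq_integral_rpow_norm two_ne_zero ENNReal.ofNat_ne_top]
  have h0 : 0 ≤ ∫ x, ‖f x‖ ^ 2 ∂μ := integral_nonneg fun x => sq_nonneg _
  have h2 : ∀ x, ‖f x‖ ^ (2 : ℝ≥0∞).toReal = ‖f x‖ ^ 2 := fun x => by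
    rw [ENNReal.toReal_ofNat, Real.rpow_ofNat]
  simp only [h2]
  rw [ENNReal.toReal_ofReal (Real.rpow_nonneg h0 _), ENNReal.toReal_ofNat, ← Real.rpow_natCast,
    ← Real.rpow_mul h0]
  norm_num

/-- This holds for negative numbers, too, as their square root is `0` by convention. -/
theorem Real.sq_sqrt_sub_sqrt_le (a b : ℝ) : (√a - √b) ^ 2 ≤ |a - b| := by
  wlog hab : b ≤ a generalizing a b
  · rw [abs_sub_comm, ← neg_sq, neg_sub]
    exact this b a (le_of_not_ge hab)
  rw [abs_of_nonneg (sub_nonneg.2 hab)]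
  rcases le_total 0 b with hb | hb
  · have h1 := Real.sq_sqrt hb
    have h2 := Real.sq_sqrt (hb.trans hab)
    have h3 := Real.sqrt_le_sqrt hab
    nlinarith [Real.sqrt_nonneg b]
  · rw [Real.sqrt_eq_zero_of_nonpos hb, sub_zero]
    rcases le_total 0 a with ha | ha
    · rw [Real.sq_sqrt ha]
      linarith
    · rw [Real.sqrt_eq_zero_of_nonpos ha]
      nlinarith

theorem memLp_two_sqrt (h : Lp ℝ 1 μ) : MemLp (fun x => ((√(h x) : ℝ) : ℂ)) 2 μ := by
  have hm : AEStronglyMeasurable (fun x => ((√(h x) : ℝ) : ℂ)) μ :=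
    (Complex.continuous_ofReal.comp Real.continuous_sqrt).comp_aestronglyMeasurable
      (Lp.aestronglyMeasurable h)
  rw [memLp_two_iff_integrable_sq_norm hm]
  refine (L1.integrable_coeFn h).norm.mono' (hm.norm.pow 2) (Eventually.of_forall fun x => ?_)
  have h1 := Real.sq_sqrt_sub_sqrt_le (h x) 0
  rw [Real.sqrt_zero, sub_zero, sub_zero] at h1
  rw [Complex.norm_real, Real.norm_of_nonneg (sq_nonneg _), Real.norm_eq_abs, sq_abs]
  exact h1

/-- The square root `√h` of an element of `L¹`, as an element of `L²`. It vanishes where `h` is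
negative. -/
def sqrtL1 (h : Lp ℝ 1 μ) : Lp ℂ 2 μ := (memLp_two_sqrt h).toLp _

theorem sqrtL1_coeFn (h : Lp ℝ 1 μ) : sqrtL1 h =ᵐ[μ] fun x => ((√(h x) : ℝ) : ℂ) :=
  (memLp_two_sqrt h).coeFn_toLp

theorem norm_sqrtL1_sq {h : Lp ℝ 1 μ} (h0 : 0 ≤ h) : ‖sqrtL1 h‖ ^ 2 = integralL1 μ h := by
  rw [norm_sq_eq_integral_norm_sq, integralL1_apply]
  refine integral_congr_ae ?_
  filter_upwards [sqrtL1_coeFn h, (Lp.coeFn_nonneg h).2 h0] with x h1 h2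
  rw [h1, Complex.norm_real, Real.norm_eq_abs, sq_abs, Real.sq_sqrt h2]

theorem norm_sqrtL1_sub_sq_le (h k : Lp ℝ 1 μ) : ‖sqrtL1 h - sqrtL1 k‖ ^ 2 ≤ ‖h - k‖ := by
  rw [norm_sq_eq_integral_norm_sq, L1.norm_eq_integral_norm]
  refine integral_mono_ae ?_ (L1.integrable_coeFn _).norm ?_
  · exact (memLp_two_iff_integrable_sq_norm (Lp.aestronglyMeasurable _)).1 (Lp.memLp _)
  · filter_upwards [sqrtL1_coeFn h, sqrtL1_coeFn k, Lp.coeFn_sub (sqrtL1 h) (sqrtL1 k),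
      Lp.coeFn_sub h k] with x h1 h2 h3 h4
    rw [h3, h4, Pi.sub_apply, Pi.sub_apply, h1, h2, ← Complex.ofReal_sub, Complex.norm_real,
      Real.norm_eq_abs, sq_abs]
    exact Real.sq_sqrt_sub_sqrt_le _ _

end SquareRoot

section AlmostInvariant

open Filter Topology

variable {G : Type u} [Group G] [TopologicalSpace G] [IsTopologicalGroup G]
  [LocallyCompactSpace G] [T2Space G] [SecondCountableTopology G]
  [MeasurableSpace G] [BorelSpace G] {μ : Measure G} [μ.IsHaarMeasure]

theorem translateLp_sqrtL1 (g : G) (h : Lp ℝ 1 μ) :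
    translateLp μ ℂ g (sqrtL1 h) = sqrtL1 (translateLp μ ℝ g h) := by
  apply Lp.ext
  have h1 := (measurePreserving_mul_left μ g⁻¹).quasiMeasurePreserving.ae_eq_comp (sqrtL1_coeFn h)
  filter_upwards [translateLp_coeFn μ ℂ g (sqrtL1 h), sqrtL1_coeFn (translateLp μ ℝ g h),
    translateLp_coeFn μ ℝ g h, h1] with x h2 h3 h4 h5
  rw [h2, h3, h4]
  exact h5

/-- An amenable group admits a sequence of probability densities which is asymptotically
annihilated by convolution with all functions of integral zero. As `L¹(G)` is separable, only
countably many such functions have to be considered. -/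
theorem IsAmenableGroup.exists_seq_densities (h : IsAmenableGroup μ) :
    ∃ k : ℕ → Lp ℝ 1 μ, (∀ n, k n ∈ densities μ) ∧
      ∀ b : Lp ℝ 1 μ, integralL1 μ b = 0 → Tendsto (fun n => ‖convL1 μ b (k n)‖) atTop (𝓝 0) := by
  have : Fact ((1 : ℝ≥0∞) ≠ ∞) := ⟨ENNReal.one_ne_top⟩
  have : SecondCountableTopology (Lp ℝ 1 μ) := Lp.SecondCountableTopology
  have : Nonempty {b : Lp ℝ 1 μ // integralL1 μ b = 0} := ⟨⟨0, map_zero _⟩⟩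
  obtain ⟨s, hs⟩ := TopologicalSpace.exists_dense_seq {b : Lp ℝ 1 μ // integralL1 μ b = 0}
  have hk : ∀ n : ℕ, ∃ k ∈ densities μ, ∀ i : Fin (n + 1),
      ‖convL1 μ (s i : Lp ℝ 1 μ) k‖ < 1 / ((n : ℝ) + 1) := fun n =>
    h.exists_density_norm_convL1_lt (fun i => (s i).2) Nat.one_div_pos_of_nat
  choose k hk hsk using hk
  refine ⟨k, hk, fun b hb => ?_⟩
  rw [Metric.tendsto_atTop]
  intro ε hε
  obtain ⟨j, hj⟩ := hs.exists_dist_lt ⟨b, hb⟩ (half_pos hε)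
  rw [Subtype.dist_eq, dist_eq_norm] at hj
  obtain ⟨N, hN⟩ := exists_nat_one_div_lt (half_pos hε)
  refine ⟨max N j, fun n hn => ?_⟩
  have hn1 : N ≤ n := (le_max_left _ _).trans hn
  have hn2 : j ≤ n := (le_max_right _ _).trans hn
  rw [Real.dist_0_eq_abs, abs_norm]
  have h1 : ‖convL1 μ (s j : Lp ℝ 1 μ) (k n)‖ < ε / 2 := by
    refine (hsk n ⟨j, Nat.lt_succ_of_le hn2⟩).trans ((Nat.one_div_le_one_div hn1).trans_lt hN)
  have h2 : ‖convL1 μ (b - s j) (k n)‖ ≤ ‖b - (s j : Lp ℝ 1 μ)‖ := by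
    have h3 : ‖k n‖ = 1 := by rw [← integralL1_eq_norm (hk n).1, (hk n).2]
    refine (ContinuousLinearMap.le_opNorm _ _).trans ?_
    rw [h3, mul_one]
    exact norm_averageL1_le _ _ _
  have h3 : convL1 μ b (k n) = convL1 μ (b - s j) (k n) + convL1 μ (s j : Lp ℝ 1 μ) (k n) := by
    rw [map_sub, sub_apply, sub_add_cancel]
  rw [h3]
  refine (norm_add_le _ _).trans_lt ?_
  change ‖b - (s j : Lp ℝ 1 μ)‖ < ε / 2 at hj
  linarith

theorem integralL1_translateLp (g : G) (b : Lp ℝ 1 μ) :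
    integralL1 μ (translateLp μ ℝ g b) = integralL1 μ b := by
  rw [integralL1_apply, integralL1_apply]
  have h := integral_translateLp_smul μ g b (fun _ => (1 : ℝ))
  simpa using h

/-- The convolution of two probability densities is a probability density. -/
theorem convL1_mem_densities {b k : Lp ℝ 1 μ} (hb : b ∈ densities μ) (hk : k ∈ densities μ) :
    convL1 μ b k ∈ densities μ := by
  have hsmul : ∀ c : ℝ, 0 ≤ c → ∀ f : Lp ℝ 1 μ, 0 ≤ f → 0 ≤ c • f := by
    intro c hc f hf
    rw [← Lp.coeFn_nonneg]
    filter_upwards [(Lp.coeFn_nonneg f).2 hf, Lp.coeFn_smul c f] with x h1 h2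
    rw [h2]
    exact mul_nonneg hc h1
  have hord : IsOrderedModule ℝ (Lp ℝ 1 μ) :=
    { toPosSMulMono := .of_smul_nonneg hsmul
      toSMulPosMono := ⟨fun f hf c d hcd => by
        have h1 := hsmul (d - c) (sub_nonneg.2 hcd) f hf
        rwa [sub_smul, sub_nonneg] at h1⟩ }
  have hint := integrable_smul_apply (μ := μ) (X := Lp ℝ 1 μ)
    (V := fun y : G => translateLp μ ℝ (E := ℝ) (p := 1) y)
    (fun k : Lp ℝ 1 μ => continuous_translateLp μ ℝ ENNReal.one_ne_top k) b k
  refine ⟨?_, ?_⟩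
  · rw [convL1, averageL1_apply]
    refine integral_nonneg_of_ae ?_
    filter_upwards [(Lp.coeFn_nonneg b).2 hb.1] with y hy
    refine hsmul _ hy _ ?_
    rw [← Lp.coeFn_nonneg]
    have h1 := (measurePreserving_mul_left μ y⁻¹).quasiMeasurePreserving.ae
      ((Lp.coeFn_nonneg k).2 hk.1)
    filter_upwards [translateLp_coeFn μ ℝ y k, h1] with x h2 h3
    rw [h2]
    exact h3
  · rw [convL1, averageL1_apply, ← ContinuousLinearMap.integral_comp_comm _ hint]
    have h1 : ∀ y, integralL1 μ (b y • translateLp μ ℝ y k) = b y := by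
      intro y
      rw [map_smul, integralL1_translateLp, hk.2, smul_eq_mul, mul_one]
    simp only [h1]
    rw [← integralL1_apply, hb.2]

/-- **Reiter's property** in `L²`: an amenable group admits a sequence of unit vectors in `L²(G)`
which is asymptotically invariant under translations. They are the square roots of `b * k n` for a
fixed density `b`, as translating `b * k n` amounts to translating `b`. -/
theorem IsAmenableGroup.exists_almost_invariant (h : IsAmenableGroup μ) :
    ∃ ξ : ℕ → Lp ℂ 2 μ, (∀ n, ‖ξ n‖ = 1) ∧
      ∀ g : G, Tendsto (fun n => ‖translateLp μ ℂ g (ξ n) - ξ n‖) atTop (𝓝 0) := by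
  obtain ⟨k, hk, hconv⟩ := h.exists_seq_densities
  set b := k 0
  have hb : b ∈ densities μ := hk 0
  refine ⟨fun n => sqrtL1 (convL1 μ b (k n)), fun n => ?_, fun g => ?_⟩
  · have h1 := convL1_mem_densities hb (hk n)
    have h2 := norm_sqrtL1_sq h1.1
    rw [h1.2] at h2
    exact (pow_eq_one_iff_of_nonneg (norm_nonneg _) two_ne_zero).1 h2
  · have h1 := hconv (translateLp μ ℝ g b - b) (by rw [map_sub, integralL1_translateLp, sub_self])
    have h2 := h1.sqrt
    rw [Real.sqrt_zero] at h2
    refine squeeze_zero (fun n => norm_nonneg _) (fun n => ?_) h2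
    refine Real.le_sqrt_of_sq_le ?_
    rw [translateLp_sqrtL1, translateLp_convL1, map_sub, sub_apply]
    exact norm_sqrtL1_sub_sq_le _ _

end AlmostInvariant

/-! ### Weak containment of all representations in the regular one -/

section Intertwining

open Filter Topology

open scoped InnerProductSpace

variable {G : Type u} [Group G] [TopologicalSpace G] [IsTopologicalGroup G]
  [SecondCountableTopology G] [MeasurableSpace G] [BorelSpace G] {μ : Measure G}

theorem UnitaryRep.star_integrated_apply {H : Type v} [NormedAddCommGroup H]
    [InnerProductSpace ℂ H] [CompleteSpace H] (π : UnitaryRep G H) (f : Lp ℂ 1 μ) (v : H) :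
    star (π.integrated μ f) v = ∫ x, star (f x) • π.toHom x⁻¹ v ∂μ := by
  have hint : Integrable (fun x => star (f x) • π.toHom x⁻¹ v) μ := by
    have hf : Integrable f μ := L1.integrable_coeFn f
    refine (hf.norm.mul_const ‖v‖).mono' ?_ (Eventually.of_forall fun x => ?_)
    · exact (continuous_star.comp_aestronglyMeasurable hf.aestronglyMeasurable).smul
        ((π.continuous_orbit v).comp continuous_inv).aestronglyMeasurable
    · rw [norm_smul, norm_star, LinearIsometryEquiv.norm_map]
  refine ext_inner_left ℂ fun w => ?_
  rw [ContinuousLinearMap.star_eq_adjoint, ContinuousLinearMap.adjoint_inner_right,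
    ← integral_inner hint, π.integrated_apply, ← inner_conj_symm,
    ← integral_inner (π.integrable_smul_orbit μ f w), ← integral_conj]
  refine integral_congr_ae (Eventually.of_forall fun x => ?_)
  simp only [inner_smul_right, map_mul, inner_conj_symm]
  congr 1
  rw [← (π.toHom x⁻¹).inner_map_map, map_inv]
  congr 1
  exact LinearIsometryEquiv.symm_apply_apply (π.toHom x) w

/-- Asymptotic intertwiners asymptotically commute with the operators `∫ c(x) π(θ x) dμ(x)`, by
dominated convergence. The map `θ` is the identity for the operators `π(f)`, and the inversion for
their adjoints. -/
theorem tendsto_integral_smul_intertwiner {i j : RepIndex G} {T : ℕ → i.H →L[ℂ] j.H} {C : ℝ}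
    (hC : ∀ n, ‖T n‖ ≤ C)
    (hT : ∀ (g : G) (v : i.H),
      Tendsto (fun n => T n (i.rep.toHom g v) - j.rep.toHom g (T n v)) atTop (𝓝 0))
    {c : G → ℂ} (hc : Integrable c μ) {θ : G → G} (hθ : Continuous θ) (v : i.H) :
    Tendsto (fun n => T n (∫ x, c x • i.rep.toHom (θ x) v ∂μ) -
      ∫ x, c x • j.rep.toHom (θ x) (T n v) ∂μ) atTop (𝓝 0) := by
  have hint : ∀ (i : RepIndex G) (v : i.H),
      Integrable (fun x => c x • i.rep.toHom (θ x) v) μ := by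
    intro i v
    refine (hc.norm.mul_const ‖v‖).mono' (hc.aestronglyMeasurable.smul
      ((i.rep.continuous_orbit v).comp hθ).aestronglyMeasurable) (Eventually.of_forall fun x => ?_)
    rw [norm_smul, LinearIsometryEquiv.norm_map]
  have hTint : ∀ n, Integrable (fun x => T n (c x • i.rep.toHom (θ x) v)) μ := fun n =>
    (T n).integrable_comp (hint i v)
  have heq : ∀ n, T n (∫ x, c x • i.rep.toHom (θ x) v ∂μ) -
      ∫ x, c x • j.rep.toHom (θ x) (T n v) ∂μ =
      ∫ x, c x • (T n (i.rep.toHom (θ x) v) - j.rep.toHom (θ x) (T n v)) ∂μ := by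
    intro n
    rw [← (T n).integral_comp_comm (hint i v), ← integral_sub (hTint n) (hint j (T n v))]
    simp only [map_smul, smul_sub]
  simp only [heq]
  have h0 : (0 : j.H) = ∫ _x, (0 : j.H) ∂μ := integral_zero _ _ |>.symm
  rw [h0]
  refine tendsto_integral_of_dominated_convergence (fun x => ‖c x‖ * (C * ‖v‖ + C * ‖v‖))
    (fun n => ?_) (hc.norm.mul_const _) (fun n => Eventually.of_forall fun x => ?_)
    (Eventually.of_forall fun x => ?_)
  · have h1 := ((hTint n).sub (hint j (T n v))).aestronglyMeasurable
    refine h1.congr (Eventually.of_forall fun x => ?_)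
    simp only [Pi.sub_apply, map_smul, smul_sub]
  · rw [norm_smul]
    refine mul_le_mul_of_nonneg_left ?_ (norm_nonneg _)
    refine (norm_sub_le _ _).trans (add_le_add ?_ ?_)
    · refine ((T n).le_opNorm _).trans ?_
      rw [LinearIsometryEquiv.norm_map]
      exact mul_le_mul_of_nonneg_right (hC n) (norm_nonneg _)
    · rw [LinearIsometryEquiv.norm_map]
      exact ((T n).le_opNorm _).trans (mul_le_mul_of_nonneg_right (hC n) (norm_nonneg _))
  · have := (hT (θ x) v).const_smul (c x)
    rwa [smul_zero] at this

/-- Asymptotic intertwiners of two unitary representations of `G` are asymptotic intertwiners of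
the corresponding representations of `C*(G)`. -/
theorem tendsto_intertwiner_groupCStarAlgebra {i j : RepIndex G} {T : ℕ → i.H →L[ℂ] j.H} {C : ℝ}
    (hC : ∀ n, ‖T n‖ ≤ C)
    (hT : ∀ (g : G) (v : i.H),
      Tendsto (fun n => T n (i.rep.toHom g v) - j.rep.toHom g (T n v)) atTop (𝓝 0))
    {x : UniversalBlocks G} (hx : x ∈ GroupCStarAlgebra μ) (v : i.H) :
    Tendsto (fun n => T n (UniversalBlocks.block i x v) - UniversalBlocks.block j x (T n v))
      atTop (𝓝 0) := by
  let P : UniversalBlocks G → Prop := fun x => ∀ v, Tendsto (fun n =>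
    T n (UniversalBlocks.block i x v) - UniversalBlocks.block j x (T n v)) atTop (𝓝 0)
  have hPadd : ∀ x y, P x → P y → P (x + y) := by
    intro x y hx hy v
    have h := (hx v).add (hy v)
    rw [add_zero] at h
    refine h.congr fun n => ?_
    rw [map_add, map_add, add_apply, add_apply, map_add]
    abel
  have hPmul : ∀ x y, P x → P y → P (x * y) := by
    intro x y hx hy v
    have h1 := ((UniversalBlocks.block j x).continuous.tendsto 0).comp (hy v)
    rw [map_zero] at h1
    have h := (hx (UniversalBlocks.block i y v)).add h1
    rw [add_zero] at h
    refine h.congr fun n => ?_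
    rw [map_mul, map_mul, mul_apply_eq_comp, mul_apply_eq_comp, Function.comp_apply, map_sub]
    abel
  have hPsmul : ∀ (c : ℂ) x, P x → P (c • x) := by
    intro c x hx v
    have h := (hx v).const_smul c
    rw [smul_zero] at h
    refine h.congr fun n => ?_
    rw [map_smul, map_smul, smul_apply, smul_apply, map_smul, smul_sub]
  have hbase : ∀ f : Lp ℂ 1 μ, P (universalRep μ f) ∧ P (star (universalRep μ f)) := by
    intro f
    have hf : Integrable f μ := L1.integrable_coeFn f
    refine ⟨fun v => tendsto_integral_smul_intertwiner hC hT hf continuous_id v, fun v => ?_⟩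
    have hfs : Integrable (fun x => star (f x)) μ :=
      hf.norm.mono' (continuous_star.comp_aestronglyMeasurable hf.aestronglyMeasurable)
        (Eventually.of_forall fun x => by rw [norm_star])
    refine (tendsto_integral_smul_intertwiner hC hT hfs continuous_inv v).congr fun n => ?_
    rw [map_star, map_star, block_universalRep, block_universalRep,
      UnitaryRep.star_integrated_apply, UnitaryRep.star_integrated_apply]
  have hadj : ∀ y ∈ NonUnitalStarAlgebra.adjoin ℂ (Set.range (universalRep μ)),
      P y ∧ P (star y) := by
    intro y hy
    induction hy using NonUnitalStarAlgebra.adjoin_induction with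
    | mem y hy =>
      obtain ⟨f, rfl⟩ := hy
      exact hbase f
    | add y z _ _ hy hz =>
      refine ⟨hPadd y z hy.1 hz.1, ?_⟩
      rw [star_add]
      exact hPadd _ _ hy.2 hz.2
    | zero =>
      have h0 : P 0 := fun v => by simp
      refine ⟨h0, ?_⟩
      rw [star_zero]
      exact h0
    | mul y z _ _ hy hz =>
      refine ⟨hPmul y z hy.1 hz.1, ?_⟩
      rw [star_mul]
      exact hPmul _ _ hz.2 hy.2
    | smul c y _ hy =>
      refine ⟨hPsmul c y hy.1, ?_⟩
      rw [star_smul]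
      exact hPsmul _ _ hy.2
    | star y _ hy =>
      refine ⟨hy.2, ?_⟩
      rw [star_star]
      exact hy.1
  have hC0 : 0 ≤ C := (norm_nonneg _).trans (hC 0)
  rw [Metric.tendsto_atTop]
  intro ε hε
  have hD : 0 < C * ‖v‖ + C * ‖v‖ + 1 := by positivity
  obtain ⟨y, hy, hxy⟩ := Metric.mem_closure_iff.1 hx (ε / 2 / (C * ‖v‖ + C * ‖v‖ + 1))
    (div_pos (half_pos hε) hD)
  obtain ⟨N, hN⟩ := Metric.tendsto_atTop.1 ((hadj y hy).1 v) (ε / 2) (half_pos hε)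
  refine ⟨N, fun n hn => ?_⟩
  have h1 := hN n hn
  rw [dist_zero_right] at h1 ⊢
  rw [dist_eq_norm, lt_div_iff₀ hD] at hxy
  have hb : ∀ (i : RepIndex G) (w : i.H),
      ‖UniversalBlocks.block i (x - y) w‖ ≤ ‖x - y‖ * ‖w‖ := by
    intro i w
    refine (ContinuousLinearMap.le_opNorm _ _).trans
      (mul_le_mul_of_nonneg_right ?_ (norm_nonneg _))
    exact NonUnitalStarAlgHom.norm_apply_le (UniversalBlocks.block i) (x - y)
  have h2 : ‖T n (UniversalBlocks.block i (x - y) v) - UniversalBlocks.block j (x - y) (T n v)‖ ≤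
      ‖x - y‖ * (C * ‖v‖ + C * ‖v‖) := by
    refine (norm_sub_le _ _).trans ?_
    rw [mul_add]
    refine add_le_add ?_ ?_
    · refine ((T n).le_opNorm _).trans ?_
      calc ‖T n‖ * ‖UniversalBlocks.block i (x - y) v‖ ≤ C * (‖x - y‖ * ‖v‖) :=
            mul_le_mul (hC n) (hb i v) (norm_nonneg _) hC0
        _ = ‖x - y‖ * (C * ‖v‖) := by ring
    · refine (hb j (T n v)).trans (mul_le_mul_of_nonneg_left ?_ (norm_nonneg _))
      exact ((T n).le_opNorm _).trans (mul_le_mul_of_nonneg_right (hC n) (norm_nonneg _))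
  have h3 : T n (UniversalBlocks.block i x v) - UniversalBlocks.block j x (T n v) =
      (T n (UniversalBlocks.block i (x - y) v) - UniversalBlocks.block j (x - y) (T n v)) +
      (T n (UniversalBlocks.block i y v) - UniversalBlocks.block j y (T n v)) := by
    rw [map_sub, map_sub, sub_apply, sub_apply, map_sub]
    abel
  rw [h3]
  refine (norm_add_le _ _).trans_lt ?_
  nlinarith [norm_nonneg (x - y)]

/-- A bounded intertwiner of two unitary representations of `G` is an intertwiner of the
corresponding representations of `C*(G)`. -/
theorem intertwiner_groupCStarAlgebra {i j : RepIndex G} (T : i.H →L[ℂ] j.H)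
    (hT : ∀ (g : G) (v : i.H), T (i.rep.toHom g v) = j.rep.toHom g (T v))
    {x : UniversalBlocks G} (hx : x ∈ GroupCStarAlgebra μ) (v : i.H) :
    T (UniversalBlocks.block i x v) = UniversalBlocks.block j x (T v) := by
  have h := tendsto_intertwiner_groupCStarAlgebra (T := fun _ => T) (C := ‖T‖) (fun _ => le_rfl)
    (fun g v => by simp only [hT, sub_self]; exact tendsto_const_nhds) hx v
  exact sub_eq_zero.1 (tendsto_nhds_unique tendsto_const_nhds h)

end Intertwining

section FellAbsorption

open Filter Topology

variable {G : Type u} [Group G] [TopologicalSpace G] [IsTopologicalGroup G]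
  [LocallyCompactSpace G] [T2Space G] [SecondCountableTopology G]
  [MeasurableSpace G] [BorelSpace G] (μ : Measure G) [μ.IsHaarMeasure]
  (H : Type v) [NormedAddCommGroup H] [InnerProductSpace ℂ H]

/-- The left regular representation of `G` on the space `L²(G, μ; H)` of vector-valued
functions. -/
def regularRepVec : UnitaryRep G (Lp H 2 μ) where
  toHom :=
    { toFun := fun g =>
        { (translateLp μ ℂ g : Lp H 2 μ →ₗᵢ[ℂ] Lp H 2 μ).toLinearMap with
          invFun := translateLp μ ℂ g⁻¹
          left_inv := fun f => by
            change translateLp μ ℂ g⁻¹ (translateLp μ ℂ g f) = f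
            rw [← translateLp_mul, inv_mul_cancel, translateLp_one]
          right_inv := fun f => by
            change translateLp μ ℂ g (translateLp μ ℂ g⁻¹ f) = f
            rw [← translateLp_mul, mul_inv_cancel, translateLp_one]
          norm_map' := fun f => (translateLp μ ℂ g).norm_map f }
      map_one' := by
        ext1 f
        exact translateLp_one μ ℂ f
      map_mul' := fun g h => by
        ext1 f
        exact translateLp_mul μ ℂ g h f }
  continuous_orbit := fun f => continuous_translateLp μ ℂ ENNReal.ofNat_ne_top f

variable {H}

/-- Scalar-valued coordinates intertwine the vector-valued and the scalar-valued regular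
representations. -/
theorem compLpL_translateLp (k : H) (g : G) (F : Lp H 2 μ) :
    (innerSL ℂ k).compLpL 2 μ (translateLp μ ℂ g F) =
      translateLp μ ℂ g ((innerSL ℂ k).compLpL 2 μ F) := by
  apply Lp.ext
  have h1 := (measurePreserving_mul_left μ g⁻¹).quasiMeasurePreserving.ae_eq_comp
    ((innerSL ℂ k).coeFn_compLpL (p := 2) F)
  filter_upwards [(innerSL ℂ k).coeFn_compLpL (p := 2) (translateLp μ ℂ g F),
    translateLp_coeFn μ ℂ g F, translateLp_coeFn μ ℂ g ((innerSL ℂ k).compLpL 2 μ F), h1]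
    with x h2 h3 h4 h5
  rw [h2, h3, h4]
  exact h5.symm

theorem eq_zero_of_compLpL_eq_zero [CompleteSpace H] {F : Lp H 2 μ}
    (h : ∀ k : H, (innerSL ℂ k).compLpL 2 μ F = 0) : F = 0 := by
  obtain ⟨t, ht, hFt⟩ := (Lp.aestronglyMeasurable F).isSeparable_ae_range
  rw [Lp.eq_zero_iff_ae_eq_zero]
  refine ae_eq_zero_of_forall_dual_of_isSeparable ℂ ht (fun c => ?_) hFt
  obtain ⟨k, rfl⟩ := (InnerProductSpace.toDual ℂ H).surjective c
  have h1 := (innerSL ℂ k).coeFn_compLpL (p := 2) F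
  rw [h k] at h1
  filter_upwards [h1, Lp.coeFn_zero ℂ 2 μ] with x h2 h3
  rw [h3] at h2
  exact h2.symm

variable (π : UnitaryRep G H)

theorem memLp_smul_orbit (ξ : Lp ℂ 2 μ) (v : H) :
    MemLp (fun x => ξ x • π.toHom x⁻¹ v) 2 μ := by
  have hm : AEStronglyMeasurable (fun x => ξ x • π.toHom x⁻¹ v) μ :=
    (Lp.aestronglyMeasurable ξ).smul
      ((π.continuous_orbit v).comp continuous_inv).aestronglyMeasurable
  refine ((Lp.memLp ξ).norm.const_mul ‖v‖).of_le hm (Eventually.of_forall fun x => ?_)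
  rw [norm_smul, LinearIsometryEquiv.norm_map, norm_mul, norm_norm, norm_norm, mul_comm]

theorem norm_toLp_smul_orbit (ξ : Lp ℂ 2 μ) (v : H) :
    ‖(memLp_smul_orbit μ π ξ v).toLp _‖ = ‖ξ‖ * ‖v‖ := by
  rw [← sq_eq_sq₀ (norm_nonneg _) (by positivity), mul_pow, norm_sq_eq_integral_norm_sq,
    norm_sq_eq_integral_norm_sq, ← integral_mul_const]
  refine integral_congr_ae ?_
  filter_upwards [(memLp_smul_orbit μ π ξ v).coeFn_toLp] with x hx
  rw [hx, norm_smul, LinearIsometryEquiv.norm_map, mul_pow]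

/-- The map `v ↦ ξ(x) π(x)⁻¹ v` from `H` to `L²(G, μ; H)`, which implements Fell's absorption
principle: it intertwines `π` with the regular representation up to translating `ξ`. -/
def absorption (ξ : Lp ℂ 2 μ) : H →L[ℂ] Lp H 2 μ :=
  LinearMap.mkContinuous
    { toFun := fun v => (memLp_smul_orbit μ π ξ v).toLp _
      map_add' := fun v w => by
        rw [← MemLp.toLp_add]
        refine MemLp.toLp_congr _ _ (Eventually.of_forall fun x => ?_)
        simp only [map_add, smul_add, Pi.add_apply]
      map_smul' := fun c v => by
        rw [RingHom.id_apply, ← MemLp.toLp_const_smul]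
        refine MemLp.toLp_congr _ _ (Eventually.of_forall fun x => ?_)
        simp only [map_smul, Pi.smul_apply, smul_comm c] }
    ‖ξ‖ fun v => (norm_toLp_smul_orbit μ π ξ v).le

theorem absorption_coeFn (ξ : Lp ℂ 2 μ) (v : H) :
    absorption μ π ξ v =ᵐ[μ] fun x => ξ x • π.toHom x⁻¹ v :=
  (memLp_smul_orbit μ π ξ v).coeFn_toLp

theorem norm_absorption_apply (ξ : Lp ℂ 2 μ) (v : H) : ‖absorption μ π ξ v‖ = ‖ξ‖ * ‖v‖ :=
  norm_toLp_smul_orbit μ π ξ v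

theorem absorption_sub (ξ η : Lp ℂ 2 μ) (v : H) :
    absorption μ π (ξ - η) v = absorption μ π ξ v - absorption μ π η v := by
  apply Lp.ext
  filter_upwards [absorption_coeFn μ π (ξ - η) v, absorption_coeFn μ π ξ v,
    absorption_coeFn μ π η v, Lp.coeFn_sub ξ η,
    Lp.coeFn_sub (absorption μ π ξ v) (absorption μ π η v)] with x h1 h2 h3 h4 h5
  rw [h1, h5, Pi.sub_apply, h2, h3, h4, Pi.sub_apply, sub_smul]

theorem translateLp_absorption (ξ : Lp ℂ 2 μ) (g : G) (v : H) :
    translateLp μ ℂ g (absorption μ π ξ v) =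
      absorption μ π (translateLp μ ℂ g ξ) (π.toHom g v) := by
  apply Lp.ext
  have h1 := (measurePreserving_mul_left μ g⁻¹).quasiMeasurePreserving.ae_eq_comp
    (absorption_coeFn μ π ξ v)
  filter_upwards [translateLp_coeFn μ ℂ g (absorption μ π ξ v), h1,
    absorption_coeFn μ π (translateLp μ ℂ g ξ) (π.toHom g v), translateLp_coeFn μ ℂ g ξ]
    with x h2 h3 h4 h5
  rw [h2, h4, h5]
  refine h3.trans ?_
  simp only [Function.comp_apply, mul_inv_rev, inv_inv, map_mul]
  rfl

end FellAbsorption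

section Hulanicki

open Filter Topology

variable {G : Type u} [Group G] [TopologicalSpace G] [IsTopologicalGroup G]
  [LocallyCompactSpace G] [T2Space G] [SecondCountableTopology G]
  [MeasurableSpace G] [BorelSpace G] (μ : Measure G) [μ.IsHaarMeasure]

/-- The left regular representation, as a member of the family defining `C*(G)`. -/
def regularIndex : RepIndex G where
  H := Lp ℂ 2 μ
  rep := regularRep μ

/-- **Hulanicki's theorem**: for an amenable group, the left regular representation is faithful on
the full group C*-algebra. -/
theorem IsAmenableGroup.eq_zero_of_block_regular_eq_zero {μ : Measure G} [μ.IsHaarMeasure]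
    (h : IsAmenableGroup μ) {x : UniversalBlocks G} (hx : x ∈ GroupCStarAlgebra μ)
    (hx0 : UniversalBlocks.block (regularIndex μ) x = 0) : x = 0 := by
  obtain ⟨ξ, hξ, hinv⟩ := h.exists_almost_invariant
  suffices hall : ∀ i : RepIndex G, UniversalBlocks.block i x = 0 from
    Subtype.ext (funext hall)
  intro i
  -- `L²(G; H)` is a multiple of the regular representation, so `x` acts as zero on it.
  let j : RepIndex G := { H := Lp i.H 2 μ, rep := regularRepVec μ i.H }
  have hj : UniversalBlocks.block j x = 0 := by
    ext1 F
    refine eq_zero_of_compLpL_eq_zero μ fun k => ?_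
    have h1 := intertwiner_groupCStarAlgebra (i := j) (j := regularIndex μ)
      ((innerSL ℂ k).compLpL 2 μ) (fun g F => compLpL_translateLp μ k g F) hx F
    rw [hx0] at h1
    exact h1
  -- The isometries `absorption μ i.rep (ξ n)` asymptotically intertwine `i` with `L²(G; H)`.
  ext1 v
  have hT := tendsto_intertwiner_groupCStarAlgebra (i := i) (j := j) (C := 1)
    (T := fun n => absorption μ i.rep (ξ n)) (fun n => ?_) (fun g v => ?_) hx v
  · simp only [hj, zero_apply, sub_zero] at hT
    have h1 := hT.norm
    have h2 : ∀ n, ‖absorption μ i.rep (ξ n) (UniversalBlocks.block i x v)‖ =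
        ‖UniversalBlocks.block i x v‖ := fun n => by
      rw [norm_absorption_apply, hξ n, one_mul]
    simp only [h2, norm_zero] at h1
    exact norm_eq_zero.1 (tendsto_nhds_unique tendsto_const_nhds h1)
  · refine ContinuousLinearMap.opNorm_le_bound _ zero_le_one fun v => ?_
    rw [norm_absorption_apply, hξ n]
  · rw [tendsto_zero_iff_norm_tendsto_zero]
    have h1 := (hinv g).mul_const ‖v‖
    rw [zero_mul] at h1
    refine h1.congr fun n => ?_
    change _ = ‖absorption μ i.rep (ξ n) (i.rep.toHom g v) -
      translateLp μ ℂ g (absorption μ i.rep (ξ n) v)‖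
    rw [translateLp_absorption, ← absorption_sub, norm_absorption_apply,
      LinearIsometryEquiv.norm_map, norm_sub_rev]

end Hulanicki

/-! ### C*-algebras with given generators -/

section Separable

variable {A : Type*} [CStarAlgebra A]

theorem Submonoid.countable_closure {M : Type*} [Monoid M] {s : Set M} (hs : s.Countable) :
    (Submonoid.closure s : Set M).Countable := by
  have := hs.to_subtype
  rw [Submonoid.closure_eq_mrange, MonoidHom.coe_mrange]
  have : Countable (FreeMonoid s) := inferInstanceAs (Countable (List s))
  exact Set.countable_range _

/-- The C*-algebra generated by a separable set is separable. -/
theorem StarAlgebra.isSeparable_adjoin {s : Set A} (hs : TopologicalSpace.IsSeparable s) :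
    TopologicalSpace.IsSeparable
      ((StarAlgebra.adjoin ℂ s).topologicalClosure : Set A) := by
  obtain ⟨t, ht, hst⟩ := hs
  have h1 : TopologicalSpace.IsSeparable (StarAlgebra.adjoin ℂ t : Set A) := by
    have h2 : (StarAlgebra.adjoin ℂ t : Set A) =
        (Submodule.span ℂ (Submonoid.closure (t ∪ star t) : Set A) : Set A) := by
      rw [← Algebra.adjoin_eq_span]
      rfl
    rw [h2]
    have ht' : (star t).Countable := by
      rw [← Set.image_star]
      exact ht.image _
    exact (Submonoid.countable_closure (ht.union ht')).isSeparable.span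
  refine h1.closure.mono ?_
  change (StarAlgebra.adjoin ℂ s).topologicalClosure ≤ (StarAlgebra.adjoin ℂ t).topologicalClosure
  refine StarSubalgebra.topologicalClosure_minimal (StarAlgebra.adjoin_le ?_)
    (StarSubalgebra.isClosed_topologicalClosure _)
  refine hst.trans ?_
  rw [StarSubalgebra.topologicalClosure_coe]
  exact closure_mono (StarAlgebra.subset_adjoin ℂ t)

/-- A closed subspace that is invariant under the images of the generators and their adjoints is
invariant under the image of the C*-algebra they generate. -/
theorem StarAlgebra.apply_mem_of_generators {s : Set A} {H : Type*} [NormedAddCommGroup H]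
    [InnerProductSpace ℂ H] [CompleteSpace H]
    (ρ : (StarAlgebra.adjoin ℂ s).topologicalClosure →⋆ₐ[ℂ] (H →L[ℂ] H)) (hρ : Continuous ρ)
    {K : Submodule ℂ H} (hK : IsClosed (K : Set H))
    (hs : ∀ b : (StarAlgebra.adjoin ℂ s).topologicalClosure, (b : A) ∈ s →
      ∀ v ∈ K, ρ b v ∈ K ∧ ρ (star b) v ∈ K)
    (b : (StarAlgebra.adjoin ℂ s).topologicalClosure) {v : H} (hv : v ∈ K) : ρ b v ∈ K := by
  have hle := StarSubalgebra.le_topologicalClosure (StarAlgebra.adjoin ℂ s)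
  have key : ∀ x (hx : x ∈ StarAlgebra.adjoin ℂ s), ∀ v ∈ K,
      ρ ⟨x, hle hx⟩ v ∈ K ∧ ρ (star ⟨x, hle hx⟩) v ∈ K := by
    intro x hx
    induction hx using StarAlgebra.adjoin_induction with
    | mem x hx => exact hs ⟨x, hle (StarAlgebra.subset_adjoin ℂ s hx)⟩ hx
    | algebraMap c =>
      intro v hv
      have h1 : ρ ⟨algebraMap ℂ A c, hle (algebraMap_mem _ c)⟩ = algebraMap ℂ _ c :=
        AlgHomClass.commutes ρ c
      rw [map_star, h1, Algebra.algebraMap_eq_smul_one, star_smul, star_one]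
      exact ⟨K.smul_mem _ hv, K.smul_mem _ hv⟩
    | add x y hx hy ihx ihy =>
      intro v hv
      have h1 : ρ ⟨x + y, hle (add_mem hx hy)⟩ = ρ ⟨x, hle hx⟩ + ρ ⟨y, hle hy⟩ :=
        map_add ρ ⟨x, hle hx⟩ ⟨y, hle hy⟩
      have h2 := ihx v hv
      have h3 := ihy v hv
      rw [map_star] at h2 h3
      rw [map_star, h1, star_add]
      exact ⟨K.add_mem h2.1 h3.1, K.add_mem h2.2 h3.2⟩
    | mul x y hx hy ihx ihy =>
      intro v hv
      have h1 : ρ ⟨x * y, hle (mul_mem hx hy)⟩ = ρ ⟨x, hle hx⟩ * ρ ⟨y, hle hy⟩ :=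
        map_mul ρ ⟨x, hle hx⟩ ⟨y, hle hy⟩
      have h2 := fun v hv => (ihx v hv).2
      have h3 := fun v hv => (ihy v hv).2
      simp only [map_star] at h2 h3
      rw [map_star, h1, star_mul]
      exact ⟨(ihx _ (ihy v hv).1).1, h3 _ (h2 v hv)⟩
    | star x hx ih =>
      intro v hv
      have h1 : star (⟨star x, hle (star_mem hx)⟩ :
        (StarAlgebra.adjoin ℂ s).topologicalClosure) = ⟨x, hle hx⟩ := Subtype.ext (star_star x)
      rw [h1]
      exact ⟨(ih v hv).2, (ih v hv).1⟩
  have hcl : IsClosed {b | ρ b v ∈ K} :=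
    hK.preimage (hρ.clm_apply continuous_const)
  have hb : b ∈ closure {b : (StarAlgebra.adjoin ℂ s).topologicalClosure |
      (b : A) ∈ StarAlgebra.adjoin ℂ s} := by
    rw [closure_subtype]
    refine closure_mono ?_ b.2
    intro x hx
    exact ⟨⟨x, hle hx⟩, hx, rfl⟩
  exact closure_minimal (fun (b : (StarAlgebra.adjoin ℂ s).topologicalClosure) hb =>
    (key b hb v hv).1) hcl hb

end Separable

/-! ### Factor representations and primeness -/

section Factor

variable {H : Type v} [NormedAddCommGroup H] [InnerProductSpace ℂ H] [CompleteSpace H]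

/-- An operator commutes with the projection onto a subspace that it and its adjoint leave
invariant. -/
theorem commute_starProjection {T : H →L[ℂ] H} {K : Submodule ℂ H} [K.HasOrthogonalProjection]
    (hT : ∀ v ∈ K, T v ∈ K) (hT' : ∀ v ∈ K, star T v ∈ K) : Commute T K.starProjection := by
  ext1 v
  refine (Submodule.eq_starProjection_of_mem_orthogonal' (hT _ (K.starProjection_apply_mem v))
    (z := T (v - K.starProjection v)) ?_ ?_).symm
  · rw [Submodule.mem_orthogonal]
    intro k hk
    rw [← ContinuousLinearMap.adjoint_inner_left]
    exact (Submodule.mem_orthogonal _ _).1 (K.sub_starProjection_mem_orthogonal v) _ (hT' k hk)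
  · rw [map_sub, add_sub_cancel]
    rfl

theorem UnitaryRep.star_op {G : Type u} [Group G] [TopologicalSpace G] (π : UnitaryRep G H)
    (g : G) : star (π.op g) = π.op g⁻¹ := by
  rw [ContinuousLinearMap.star_eq_adjoint, eq_comm, ContinuousLinearMap.eq_adjoint_iff]
  intro x y
  have h : π.toHom g (π.toHom g⁻¹ x) = x := by
    change (π.toHom g * π.toHom g⁻¹) x = x
    rw [← map_mul, mul_inv_cancel, map_one]
    rfl
  rw [UnitaryRep.op_apply, UnitaryRep.op_apply, ← (π.toHom g).inner_map_map, h]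

variable {G : Type u} [Group G] [TopologicalSpace G] [SecondCountableTopology G]
  [MeasurableSpace G] [BorelSpace G] {μ : Measure G}

/-- A continuous function whose integrals against all of `L¹` vanish is zero. -/
theorem eq_zero_of_forall_integral_smul_eq_zero {G : Type*} [TopologicalSpace G]
    [MeasurableSpace G] {μ : Measure G} [μ.IsOpenPosMeasure] [SigmaFinite μ]
    {F : G → H} (hF : Continuous F)
    (hint : ∀ f : Lp ℂ 1 μ, Integrable (fun x => f x • F x) μ)
    (h0 : ∀ f : Lp ℂ 1 μ, ∫ x, f x • F x ∂μ = 0) : F = 0 := by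
  have key : ∀ s (hs : MeasurableSet s) (hμ : μ s < ∞),
      (fun x => (indicatorConstLp 1 hs hμ.ne (1 : ℂ) : Lp ℂ 1 μ) x • F x) =ᵐ[μ] s.indicator F := by
    intro s hs hμ
    filter_upwards [indicatorConstLp_coeFn (p := 1) (hs := hs) (hμs := hμ.ne) (c := (1 : ℂ))]
      with x hx
    rw [hx]
    by_cases h : x ∈ s <;> simp [h]
  have h1 : F =ᵐ[μ] 0 := by
    refine ae_eq_zero_of_forall_setIntegral_eq_of_sigmaFinite (fun s hs hμ => ?_)
      (fun s hs hμ => ?_)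
    · rw [← integrable_indicator_iff hs]
      exact (hint _).congr (key s hs hμ)
    · rw [← integral_indicator hs, ← integral_congr_ae (key s hs hμ)]
      exact h0 _
  exact (Continuous.ae_eq_iff_eq μ hF continuous_zero).1 h1

/-- If `T` kills all `π(f) v`, it kills all `π(g) v`, although `π(g)` need not be in the norm
closure of the operators `π(f)`. -/
theorem UnitaryRep.eq_zero_of_forall_integrated [μ.IsOpenPosMeasure] [SigmaFinite μ]
    (π : UnitaryRep G H) {T : H →L[ℂ] H} {v : H}
    (h : ∀ f : Lp ℂ 1 μ, T (π.integrated μ f v) = 0) (g : G) : T (π.op g v) = 0 := by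
  have h1 : (fun g => T (π.toHom g v)) = 0 := by
    refine eq_zero_of_forall_integral_smul_eq_zero (μ := μ)
      (T.continuous.comp (π.continuous_orbit v))
      (fun f => ?_) (fun f => ?_)
    · simpa using T.integrable_comp (π.integrable_smul_orbit μ f v)
    · have h2 := h f
      rw [π.integrated_apply, ← T.integral_comp_comm (π.integrable_smul_orbit μ f v)] at h2
      simpa using h2
  exact congrFun h1 g

variable (μ) in
/-- The unital C*-algebra generated by the operators `π(f)`, `f ∈ L¹(G, μ)`. -/
def UnitaryRep.generatedCStar (π : UnitaryRep G H) : StarSubalgebra ℂ (H →L[ℂ] H) :=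
  (StarAlgebra.adjoin ℂ (Set.range (π.integrated μ))).topologicalClosure

theorem UnitaryRep.isClosed_generatedCStar (π : UnitaryRep G H) :
    IsClosed (π.generatedCStar μ : Set (H →L[ℂ] H)) :=
  StarSubalgebra.isClosed_topologicalClosure _

theorem UnitaryRep.integrated_mem_generatedCStar (π : UnitaryRep G H) (f : Lp ℂ 1 μ) :
    π.integrated μ f ∈ π.generatedCStar μ :=
  StarSubalgebra.le_topologicalClosure _ (StarAlgebra.subset_adjoin ℂ _ ⟨f, rfl⟩)

instance UnitaryRep.separableSpace_generatedCStar [SigmaFinite μ] (π : UnitaryRep G H) :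
    TopologicalSpace.SeparableSpace (π.generatedCStar μ) := by
  have : Fact ((1 : ℝ≥0∞) ≠ ∞) := ⟨ENNReal.one_ne_top⟩
  exact (StarAlgebra.isSeparable_adjoin
    (TopologicalSpace.isSeparable_range (π.integrated μ).continuous)).separableSpace

/-- Operators that commute with all `π(g)` commute with the C*-algebra generated by the `π(f)`. -/
theorem UnitaryRep.commute_of_mem_generatedCStar (π : UnitaryRep G H) {t : H →L[ℂ] H}
    (ht : t ∈ StarSubalgebra.centralizer ℂ (Set.range π.op)) {b : H →L[ℂ] H}
    (hb : b ∈ π.generatedCStar μ) : Commute t b := by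
  have h0 : ∀ t ∈ StarSubalgebra.centralizer ℂ (Set.range π.op), ∀ f : Lp ℂ 1 μ,
      t * π.integrated μ f = π.integrated μ f * t := by
    intro t ht f
    ext1 v
    change t (π.integrated μ f v) = π.integrated μ f (t v)
    rw [π.integrated_apply, π.integrated_apply,
      ← t.integral_comp_comm (π.integrable_smul_orbit μ f v)]
    congr 1 with x
    rw [map_smul]
    congr 1
    exact (congrArg (fun T : H →L[ℂ] H => T v)
      ((StarSubalgebra.mem_centralizer_iff ℂ).1 ht _ ⟨x, rfl⟩).1).symm
  have h1 : π.generatedCStar μ ≤ StarSubalgebra.centralizer ℂ {t} := by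
    refine StarSubalgebra.topologicalClosure_minimal (StarAlgebra.adjoin_le ?_) ?_
    · rintro _ ⟨f, rfl⟩
      refine (StarSubalgebra.mem_centralizer_iff ℂ).2 ?_
      rintro _ rfl
      exact ⟨h0 _ ht f, h0 _ (star_mem ht) f⟩
    · rw [StarSubalgebra.coe_centralizer]
      exact Set.isClosed_centralizer _
  exact ((StarSubalgebra.mem_centralizer_iff ℂ).1 (h1 hb) t rfl).1

/-- The C*-algebra generated by a factor representation is prime: if `a B b = 0`, the projection
onto the closed invariant subspace generated by the range of `b` is in the centre of the von
Neumann algebra, so it is `0` or `1`. -/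
theorem UnitaryRep.IsFactorRep.prime [μ.IsOpenPosMeasure] [SigmaFinite μ] {π : UnitaryRep G H}
    (hπ : π.IsFactorRep)
    {a b : H →L[ℂ] H} (hb : b ∈ π.generatedCStar μ)
    (hab : ∀ x ∈ π.generatedCStar μ, a * x * b = 0) : a = 0 ∨ b = 0 := by
  have h1 : ∀ g v, a (π.op g (b v)) = 0 := fun g v =>
    π.eq_zero_of_forall_integrated (μ := μ) (T := a) (v := b v) (fun f =>
      congrArg (fun T : H →L[ℂ] H => T v) (hab _ (π.integrated_mem_generatedCStar f))) g
  let S : Submodule ℂ H := Submodule.span ℂ {w | ∃ g v, w = π.op g (b v)}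
  let K : Submodule ℂ H := S.topologicalClosure
  have hKc : IsClosed (K : Set H) := S.isClosed_topologicalClosure
  have : CompleteSpace K := hKc.completeSpace_coe
  have hSK : ∀ g v, π.op g (b v) ∈ K := fun g v =>
    S.le_topologicalClosure (Submodule.subset_span ⟨g, v, rfl⟩)
  have hinv : ∀ T : H →L[ℂ] H, (∀ g v, T (π.op g (b v)) ∈ K) → ∀ w ∈ K, T w ∈ K := by
    intro T hT
    have h2 : S ≤ K.comap T.toLinearMap := Submodule.span_le.2 (by
      rintro _ ⟨g, v, rfl⟩
      exact hT g v)
    exact S.topologicalClosure_minimal h2 (hKc.preimage T.continuous)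
  have hop : ∀ g, ∀ w ∈ K, π.op g w ∈ K := fun g => hinv _ fun k v => by
    have h3 : π.op g (π.op k (b v)) = π.op (g * k) (b v) := by
      simp [map_mul]
    rw [h3]
    exact hSK _ v
  have hcent : ∀ t ∈ StarSubalgebra.centralizer ℂ (Set.range π.op), ∀ w ∈ K, t w ∈ K :=
    fun t ht => hinv t fun g v => by
      have h4 : t (π.op g (b v)) = π.op g (b (t v)) := by
        have h5 := congrArg (fun T : H →L[ℂ] H => T (b v))
          ((StarSubalgebra.mem_centralizer_iff ℂ).1 ht _ ⟨g, rfl⟩).1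
        have h6 := congrArg (fun T : H →L[ℂ] H => T v) (π.commute_of_mem_generatedCStar ht hb).eq
        exact h5.symm.trans (congrArg (π.op g) h6)
      rw [h4]
      exact hSK _ _
  have hp1 : K.starProjection ∈ StarSubalgebra.centralizer ℂ (Set.range π.op) := by
    refine (StarSubalgebra.mem_centralizer_iff ℂ).2 ?_
    have h7 : ∀ g, Commute (π.op g) K.starProjection := fun g =>
      commute_starProjection (hop g) (by rw [π.star_op]; exact hop g⁻¹)
    rintro _ ⟨g, rfl⟩
    exact ⟨h7 g, by rw [π.star_op]; exact h7 g⁻¹⟩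
  have hp2 : K.starProjection ∈ VonNeumannAlgebra.generated (Set.range π.op) := by
    refine (StarSubalgebra.mem_centralizer_iff ℂ).2 fun t ht => ?_
    have h8 : ∀ t ∈ StarSubalgebra.centralizer ℂ (Set.range π.op), Commute t K.starProjection :=
      fun t ht => commute_starProjection (hcent t ht) (hcent _ (star_mem ht))
    exact ⟨h8 t ht, h8 _ (star_mem ht)⟩
  have hp3 : K.starProjection ∈ (VonNeumannAlgebra.generated (Set.range π.op)).commutant :=
    VonNeumannAlgebra.mem_commutant_iff.2 fun m hm =>
      ((StarSubalgebra.mem_centralizer_iff ℂ).1 hm _ hp1).1.symm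
  obtain ⟨c, hc⟩ := hπ.2 _ hp2 hp3
  have hbK : ∀ v, b v ∈ K := fun v => by
    have := hSK 1 v
    rwa [UnitaryRep.op_apply, map_one] at this
  refine or_iff_not_imp_right.2 fun hb0 => ?_
  obtain ⟨v, hv⟩ : ∃ v, b v ≠ 0 := by
    by_contra! h
    exact hb0 (ContinuousLinearMap.ext h)
  have hc0 : c ≠ 0 := by
    rintro rfl
    have h9 := Submodule.starProjection_eq_self_iff.2 (hbK v)
    rw [hc, zero_smul] at h9
    exact hv h9.symm
  have haK : ∀ w ∈ K, a w = 0 := by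
    have h2 : S ≤ LinearMap.ker a.toLinearMap := Submodule.span_le.2 (by
      rintro _ ⟨g, v, rfl⟩
      exact h1 g v)
    exact S.topologicalClosure_minimal h2 (isClosed_singleton.preimage a.continuous)
  ext1 w
  refine haK w ?_
  have h10 : K.starProjection w = c • w := by rw [hc]; rfl
  exact (K.smul_mem_iff hc0).1 (h10 ▸ K.starProjection_apply_mem w)

end Factor

/-! ### Primitivity of the group C*-algebra -/

section GroupCStarAlgebra

variable {G : Type u} [Group G] [TopologicalSpace G] [SecondCountableTopology G]
  [MeasurableSpace G] [BorelSpace G] {μ : Measure G}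

/-- A representation maps `C*(G)` into the C*-algebra generated by the operators `π(f)`. -/
theorem block_mem_generatedCStar (i : RepIndex G) {x : UniversalBlocks G}
    (hx : x ∈ GroupCStarAlgebra μ) : UniversalBlocks.block i x ∈
      i.rep.generatedCStar μ := by
  have hc : Continuous (UniversalBlocks.block i) :=
    AddMonoidHomClass.continuous_of_bound (UniversalBlocks.block i) 1 fun x => by
      rw [one_mul]
      exact NonUnitalStarAlgHom.norm_apply_le (UniversalBlocks.block i) x
  have h1 : NonUnitalStarAlgebra.adjoin ℂ (Set.range (universalRep μ)) ≤
      NonUnitalStarSubalgebra.comap (UniversalBlocks.block i)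
        (i.rep.generatedCStar μ).toNonUnitalStarSubalgebra := by
    refine NonUnitalStarAlgebra.adjoin_le ?_
    rintro _ ⟨f, rfl⟩
    exact i.rep.integrated_mem_generatedCStar f
  exact NonUnitalStarSubalgebra.topologicalClosure_minimal _ h1
    (i.rep.isClosed_generatedCStar.preimage hc) hx

end GroupCStarAlgebra

end

theorem lemma3p8 {G : Type u} [Group G] [TopologicalSpace G] [IsTopologicalGroup G]
    [LocallyCompactSpace G] [T2Space G] [SecondCountableTopology G]
    [MeasurableSpace G] [BorelSpace G] (μ : Measure G) [μ.IsHaarMeasure]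
    (hamen : IsAmenableGroup μ) (hfactor : (regularRep μ).IsFactorRep) :
    IsPrimitiveCStarAlgebra.{u + 1, u} (GroupCStarAlgebra μ) := by
  let i := regularIndex μ
  let B := (regularRep μ).generatedCStar μ
  have hBc : IsClosed (B : Set (Lp ℂ 2 μ →L[ℂ] Lp ℂ 2 μ)) :=
    (regularRep μ).isClosed_generatedCStar
  let _ : CStarAlgebra B := StarSubalgebra.cstarAlgebra B
  have := hfactor.1
  have : Nontrivial B := inferInstance
  obtain ⟨H, _, _, _, ρ, hρ, hirr⟩ := exists_injective_irreducible_of_prime (B := B)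
    (fun a b hab => by
      have h1 := hfactor.prime (μ := μ) (a := a.1) b.2
        fun x hx => congrArg Subtype.val (hab ⟨x, hx⟩)
      exact h1.imp Subtype.ext Subtype.ext)
    B.subtype Subtype.val_injective
  let j : GroupCStarAlgebra μ →⋆ₙₐ[ℂ] B :=
    { toFun := fun x => ⟨UniversalBlocks.block i x, block_mem_generatedCStar i x.2⟩
      map_smul' := fun _ _ => rfl
      map_zero' := rfl
      map_add' := fun _ _ => rfl
      map_mul' := fun _ _ => rfl
      map_star' := fun _ => rfl }
  have hj : Function.Injective j := by
    refine (injective_iff_map_eq_zero j).2 fun x hx => Subtype.ext ?_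
    exact hamen.eq_zero_of_block_regular_eq_zero x.2 (congrArg Subtype.val hx)
  let ι : Lp ℂ 1 μ → GroupCStarAlgebra μ := fun f => ⟨universalRep μ f,
    NonUnitalStarSubalgebra.le_topologicalClosure _
      (NonUnitalStarAlgebra.subset_adjoin ℂ _ ⟨f, rfl⟩)⟩
  let σ : GroupCStarAlgebra μ →⋆ₙₐ[ℂ] (H →L[ℂ] H) :=
    (ρ : B →⋆ₙₐ[ℂ] (H →L[ℂ] H)).comp j
  have hσ : Function.Injective σ := hρ.comp hj
  refine ⟨H, _, _, _, σ, ⟨?_, fun K hK hinv => hirr K hK fun b v hv => ?_⟩, hσ⟩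
  · -- Some `λ(f)` is nonzero: otherwise all the unitaries `λ(g)` would vanish.
    by_contra! h
    obtain ⟨v, hv⟩ := exists_ne (0 : Lp ℂ 2 μ)
    refine hv ?_
    have h1 := (regularRep μ).eq_zero_of_forall_integrated (μ := μ) (T := 1) (v := v) (fun f => by
      have h2 : ι f = 0 := hσ (by rw [h, map_zero])
      have h3 : (regularRep μ).integrated μ f = 0 :=
        congrArg (fun x : GroupCStarAlgebra μ => UniversalBlocks.block i x.1) h2
      rw [h3]
      rfl) 1
    rw [UnitaryRep.op_apply, map_one] at h1
    exact h1
  · refine StarAlgebra.apply_mem_of_generators (s := Set.range ((regularRep μ).integrated μ))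
      ρ (AddMonoidHomClass.continuous_of_bound ρ 1 fun x => ?_) hK ?_ b hv
    · rw [one_mul]
      exact NonUnitalStarAlgHom.norm_apply_le ρ x
    rintro ⟨_, hb⟩ ⟨f, rfl⟩ v hv
    exact ⟨hinv (ι f) v hv, hinv (star (ι f)) v hv⟩
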